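/- Theorem 1. Let $T=(V,E)$ be a tree on a finite set $V$ of at least two users, let $\mathbb{F}_q$ be a finite field, and let $X=(X_{e,k}: e\in E,\ 1\le k\le n_e)$, with integers $n_e\ge 0$, be i.i.d. and uniform on $\mathbb{F}_q$. Put $Y_e=(X_{e,1},\dots,X_{e,n_e})$. User $i\in V$ observes $Z_i=(Y_e: e \text{ incident to } i)$, and the wiretapper observes $Z_{\mathrm w}=XW$, where $W$ is a $(\sum_e n_e)\times n_{\mathrm w}$ matrix over $\mathbb{F}_q$ of full column rank (a tree-PIN source with linear wiretapper). Let $Z_V=(Z_i)_{i\in V}$; a superscript $n$ denotes $n$ i.i.d. realizations. All entropies, and all logarithms, are to base $2$. Given $n$ realizations, the users hold an interactive public discussion $F^{(n)}$ in finitely many rounds with finite message alphabets: each message of user $i$ is a function of $Z_i^n$, of private randomness of user $i$ (independent across the users and independent of the source) and of the messages of the earlier rounds. Afterwards user $i$ outputs a value $E_i^{(n)}$, a function of $Z_i^n$, its private randomness and $F^{(n)}$. The discussion is linear and non-interactive if it consists of one round in which each user $i$ sends an $\mathbb{F}_q$-linear function of $Z_i^n$. An omniscience scheme is a sequence of discussions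 and outputs with $\Pr(E_i^{(n)}=Z_V^n\ \text{for all } i\in V)\to 1$ as $n\to\infty$; its leakage rate is $\limsup_n \frac1n I(F^{(n)};Z_V^n\mid Z_{\mathrm w}^n)$, and $R_{\mathrm L}$ is the infimum of the leakage rates of all omniscience schemes. A secret key agreement scheme is a sequence of discussions, outputs and random variables $K^{(n)}$ with values in finite sets $\mathcal K^{(n)}$ such that $\Pr(E_i^{(n)}=K^{(n)}\ \text{for all } i\in V)\to 1$ and $\log_2|\mathcal K^{(n)}|-H(K^{(n)}\mid F^{(n)},Z_{\mathrm w}^n)\to 0$; its rate is $\liminf_n\frac1n\log_2|\mathcal K^{(n)}|$, and $C_{\mathrm W}$ is the supremum of the rates of all secret key agreement schemes. A maximal common function $\mathrm{mcf}(A,B)$ of two random variables is a random variable $G$ of largest entropy subject to $H(G\mid A)=H(G\mid B)=0$. Then $$C_{\mathrm W}=\min_{e\in E}H\bigl(Y_e\mid \mathrm{mcf}(Y_e,Z_{\mathrm w})\bigr),\qquad R_{\mathrm L}=\Bigl(\sum_{e\in E}n_e-n_{\mathrm w}\Bigr)\log_2 q-C_{\mathrm W}.$$ Moreover, there is a sequence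 of linear non-interactive discussions $F^{(n)}$ which, with suitable outputs, is an omniscience scheme with leakage rate exactly $R_{\mathrm L}$ and, with suitable keys and outputs, is also a secret key agreement scheme with rate exactly $C_{\mathrm W}$. -/

import Mathlib

open MeasureTheory Filter Topology

noncomputable section

namespace TreePIN

/-! ### Entropies of finite-valued random variables (in bits) -/

/-- Shannon entropy `H(X)`, in bits, of a random variable with values in a finite set. -/
def entropy {Ω α : Type*} [MeasurableSpace Ω] [Finite α] (μ : Measure Ω) (X : Ω → α) : ℝ :=
  ∑' x : α, -(μ.real (X ⁻¹' {x}) * Real.logb 2 (μ.real (X ⁻¹' {x})))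

/-- Conditional entropy `H(X | Y) = H(X, Y) - H(Y)`. -/
def condEntropy {Ω α β : Type*} [MeasurableSpace Ω] [Finite α] [Finite β] (μ : Measure Ω)
    (X : Ω → α) (Y : Ω → β) : ℝ :=
  entropy μ (fun ω => (X ω, Y ω)) - entropy μ Y

/-- Conditional mutual information `I(X ∧ Y | Z) = H(X | Z) - H(X | Y, Z)`. -/
def condMutualInfo {Ω α β δ : Type*} [MeasurableSpace Ω] [Finite α] [Finite β] [Finite δ]
    (μ : Measure Ω) (X : Ω → α) (Y : Ω → β) (Z : Ω → δ) : ℝ :=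
  condEntropy μ X Z - condEntropy μ X (fun ω => (Y ω, Z ω))

/-! ### Common functions -/

/-- `G` is a common function of `X` and `Y`: a random variable with
`H(G | X) = H(G | Y) = 0`. -/
def IsCommonFunction {Ω α β γ : Type*} [MeasurableSpace Ω] [Finite α] [Finite β] [Finite γ]
    (μ : Measure Ω) (X : Ω → α) (Y : Ω → β) (G : Ω → γ) : Prop :=
  (∀ g, MeasurableSet (G ⁻¹' {g})) ∧ condEntropy μ G X = 0 ∧ condEntropy μ G Y = 0

/-- `G` is a maximal common function of `X` and `Y`: a common function whose entropy is largest
among all finite-valued common functions. -/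
def IsMaximalCommonFunction {Ω α β γ : Type*} [MeasurableSpace Ω] [Finite α] [Finite β] [Finite γ]
    (μ : Measure Ω) (X : Ω → α) (Y : Ω → β) (G : Ω → γ) : Prop :=
  IsCommonFunction μ X Y G ∧
    ∀ (k : ℕ) (G' : Ω → Fin k), IsCommonFunction μ X Y G' → entropy μ G' ≤ entropy μ G

/-- Relabelling the values of a random variable does not change its entropy. -/
theorem entropy_relabel {Ω α β : Type*} [MeasurableSpace Ω] [Finite α] [Finite β] (μ : Measure Ω)
    (X : Ω → α) (f : α → β) (hf : Set.InjOn f (Set.range X)) :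
    entropy μ (fun ω => f (X ω)) = entropy μ X := by
  have h1 : entropy μ X = ∑' x : Set.range X,
      -(μ.real (X ⁻¹' {(x : α)}) * Real.logb 2 (μ.real (X ⁻¹' {(x : α)}))) := by
    refine ((Subtype.val_injective (p := fun x => x ∈ Set.range X)).tsum_eq ?_).symm
    intro x hx
    by_contra hne
    have : X ⁻¹' {x} = ∅ := by
      ext ω
      simp only [Set.mem_preimage, Set.mem_singleton_iff, Set.mem_empty_iff_false, iff_false]
      rintro rfl
      exact hne ⟨⟨X ω, ω, rfl⟩, rfl⟩
    simp [this] at hx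
  have hinj : Function.Injective (fun x : Set.range X => f x) :=
    fun a b h => Subtype.ext (hf a.2 b.2 h)
  have h2 : entropy μ (fun ω => f (X ω)) = ∑' x : Set.range X,
      -(μ.real ((fun ω => f (X ω)) ⁻¹' {f x}) *
        Real.logb 2 (μ.real ((fun ω => f (X ω)) ⁻¹' {f x}))) := by
    refine (hinj.tsum_eq ?_).symm
    intro x hx
    by_contra hne
    have : (fun ω => f (X ω)) ⁻¹' {x} = ∅ := by
      ext ω
      simp only [Set.mem_preimage, Set.mem_singleton_iff, Set.mem_empty_iff_false, iff_false]
      rintro rfl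
      exact hne ⟨⟨X ω, ω, rfl⟩, rfl⟩
    simp [this] at hx
  rw [h1, h2]
  refine tsum_congr fun x => ?_
  have : (fun ω => f (X ω)) ⁻¹' {f x} = X ⁻¹' {(x : α)} := by
    ext ω
    simp only [Set.mem_preimage, Set.mem_singleton_iff]
    exact ⟨fun h => hf ⟨ω, rfl⟩ x.2 h, fun h => by rw [h]⟩
  rw [this]

/-- Relabelling `X` does not change `H(X | Y)`. -/
theorem condEntropy_relabel {Ω α β δ : Type*} [MeasurableSpace Ω] [Finite α] [Finite β] [Finite δ]
    (μ : Measure Ω) (X : Ω → α) (f : α → β) (hf : Set.InjOn f (Set.range X)) (Y : Ω → δ) :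
    condEntropy μ (fun ω => f (X ω)) Y = condEntropy μ X Y := by
  have h := entropy_relabel μ (fun ω => (X ω, Y ω)) (fun p => (f p.1, p.2)) (by
    rintro _ ⟨a, rfl⟩ _ ⟨b, rfl⟩ h
    obtain ⟨h1, h2⟩ := Prod.ext_iff.1 h
    exact Prod.ext (hf ⟨a, rfl⟩ ⟨b, rfl⟩ h1) h2)
  simp only [condEntropy]
  rw [← h]

/-- A constant `c` satisfies `H(c | Y) = 0`. -/
theorem condEntropy_const {Ω α δ : Type*} [MeasurableSpace Ω] [Finite α] [Finite δ]
    (μ : Measure Ω) (c : α) (Y : Ω → δ) : condEntropy μ (fun _ => c) Y = 0 := by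
  have h := entropy_relabel μ Y (fun z => (c, z)) (fun a _ b _ h => (Prod.ext_iff.1 h).2)
  simp only [condEntropy]
  rw [h, sub_self]

/-- Maximal common functions exist on every nonempty finite discrete space. -/
theorem exists_isMaximalCommonFunction {Ω α β : Type*} [MeasurableSpace Ω]
    [DiscreteMeasurableSpace Ω] [Finite Ω] [Nonempty Ω] [Finite α] [Finite β]
    (μ : Measure Ω) (X : Ω → α) (Y : Ω → β) :
    ∃ G : Ω → Ω, IsMaximalCommonFunction μ X Y G := by
  classical
  obtain ⟨o⟩ := ‹Nonempty Ω›
  obtain ⟨G, hG, hmax⟩ := Set.exists_max_image _ (fun G : Ω → Ω => entropy μ G)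
    (Set.toFinite {G : Ω → Ω | IsCommonFunction μ X Y G})
    ⟨fun _ => o, fun _ => .of_discrete, condEntropy_const μ o X, condEntropy_const μ o Y⟩
  refine ⟨G, hG, fun k G' hG' => ?_⟩
  let f : Fin k → Ω := fun j => if h : ∃ ω, G' ω = j then h.choose else o
  have hf : Set.InjOn f (Set.range G') := by
    rintro a ha b hb h
    have ha' : ∃ ω, G' ω = a := ha
    have hb' : ∃ ω, G' ω = b := hb
    simp only [f, dif_pos ha', dif_pos hb'] at h
    rw [← ha'.choose_spec, ← hb'.choose_spec, h]
  rw [← entropy_relabel μ G' f hf]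
  exact hmax _ ⟨fun _ => .of_discrete, (condEntropy_relabel μ G' f hf X).trans hG'.2.1,
    (condEntropy_relabel μ G' f hf Y).trans hG'.2.2⟩

/-! ### Multiterminal sources with wiretapper side information -/

/-- A finite multiterminal source: the joint law of the observations `Z_i` of the users `i : V` and
of the side information `Z_w` of the wiretapper, all given as functions of one finite random
variable, the base, with a given law. -/
structure WiretapSource (V : Type) where
  Base : Type
  [baseFinite : Finite Base]
  law : PMF Base
  Obs : V → Type
  [obsFinite : ∀ i, Finite (Obs i)]
  obs : ∀ i, Base → Obs i
  Wt : Type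
  [wtFinite : Finite Wt]
  wt : Base → Wt

attribute [instance] WiretapSource.baseFinite WiretapSource.obsFinite WiretapSource.wtFinite

namespace WiretapSource

variable {V : Type}

/-- Finite alphabets are discrete. -/
instance (src : WiretapSource V) : MeasurableSpace src.Base := ⊤

/-- The law of one realization of the base. -/
def baseLaw (src : WiretapSource V) : Measure src.Base := src.law.toMeasure

end WiretapSource

/-! ### Public discussion -/

/-- What has been said on the public channel, by all users, in the first `t` rounds. `Msg t i` is
the message alphabet of user `i` in round `t`. -/
def History {V : Type} (Msg : ℕ → V → Type) : ℕ → Type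
  | 0 => Unit
  | t + 1 => History Msg t × (∀ i, Msg t i)

instance {V : Type} [Finite V] (Msg : ℕ → V → Type) [∀ t i, Finite (Msg t i)] (t : ℕ) :
    Finite (History Msg t) := by
  induction t with
  | zero => exact inferInstanceAs (Finite Unit)
  | succ t ih => exact inferInstanceAs (Finite (History Msg t × (∀ i, Msg t i)))

/-- An interactive public discussion based on `n` realizations of the source. User `i` has private
randomness in an arbitrary probability space `Rand i`. There are finitely many rounds, and the
message of a user in a round is a function of its `n` observations, its private randomness and all
the communication of the previous rounds. (Only the rounds `t < rounds` are used.) -/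
structure Discussion {V : Type} (src : WiretapSource V) (n : ℕ) where
  Rand : V → Type
  [randMeasurable : ∀ i, MeasurableSpace (Rand i)]
  randLaw : ∀ i, Measure (Rand i)
  [randProb : ∀ i, IsProbabilityMeasure (randLaw i)]
  rounds : ℕ
  Msg : ℕ → V → Type
  [msgFinite : ∀ t i, Finite (Msg t i)]
  send : ∀ t i, (Fin n → src.Obs i) → Rand i → History Msg t → Msg t i
  send_measurable : ∀ t i z h m, MeasurableSet {r | send t i z r h = m}

attribute [instance] Discussion.randMeasurable Discussion.randProb Discussion.msgFinite

namespace Discussion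

variable {V : Type} {src : WiretapSource V} {n : ℕ}

/-- A sample point: `n` realizations of the base, and the private randomness of every user. -/
abbrev Sample (D : Discussion src n) : Type := (Fin n → src.Base) × (∀ i, D.Rand i)

/-- The realizations of the base are i.i.d., and the private randomness of the users is mutually
independent and independent of the source. -/
def law [Fintype V] (D : Discussion src n) : Measure D.Sample :=
  (Measure.pi fun _ : Fin n => src.baseLaw).prod (Measure.pi D.randLaw)

/-- `Z_i^n`. -/
def obsBlock (D : Discussion src n) (i : V) (ω : D.Sample) : Fin n → src.Obs i :=
  fun t => src.obs i (ω.1 t)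

/-- `Z_V^n`. -/
def allObsBlock (D : Discussion src n) (ω : D.Sample) : ∀ i, Fin n → src.Obs i :=
  fun i => D.obsBlock i ω

/-- `Z_w^n`. -/
def wtBlock (D : Discussion src n) (ω : D.Sample) : Fin n → src.Wt :=
  fun t => src.wt (ω.1 t)

/-- The communication of the first `t` rounds. -/
def history (D : Discussion src n) (ω : D.Sample) : ∀ t, History D.Msg t
  | 0 => ()
  | t + 1 => (D.history ω t, fun i => D.send t i (D.obsBlock i ω) (ω.2 i) (D.history ω t))

/-- The alphabet of the whole communication. -/
abbrev Transcript (D : Discussion src n) : Type := History D.Msg D.rounds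

/-- The whole communication `F^(n)`. -/
def transcript (D : Discussion src n) (ω : D.Sample) : D.Transcript := D.history ω D.rounds

/-- The final outputs `E_i^(n)` of the users, with values in `α`. User `i` uses its `n`
observations, its private randomness and the communication. -/
structure Outputs (D : Discussion src n) (α : Type) where
  out : ∀ i, (Fin n → src.Obs i) → D.Rand i → D.Transcript → α
  out_measurable : ∀ i z f a, MeasurableSet {r | out i z r f = a}

/-- The output of user `i` as a random variable. -/
def Outputs.eval {D : Discussion src n} {α : Type} (E : D.Outputs α) (i : V) (ω : D.Sample) : α :=
  E.out i (D.obsBlock i ω) (ω.2 i) (D.transcript ω)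

end Discussion

/-! ### Secure omniscience and secret key agreement -/

section Capacities

variable {V : Type} [Fintype V]

/-- An omniscience scheme: for every `n` a discussion after which, with probability tending to `1`,
all users output `Z_V^n`. -/
structure OmniscienceScheme (src : WiretapSource V) where
  disc : ∀ n, Discussion src n
  outputs : ∀ n, (disc n).Outputs (∀ i, Fin n → src.Obs i)
  recoverability : Tendsto (fun n => (disc n).law.real
    {ω | ∀ i, (outputs n).eval i ω = (disc n).allObsBlock ω}) atTop (𝓝 1)

/-- The leakage rate `limsup (1/n) I(F^(n) ∧ Z_V^n | Z_w^n)` of an omniscience scheme. -/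
def OmniscienceScheme.leakageRate {src : WiretapSource V} (S : OmniscienceScheme src) : EReal :=
  limsup (fun n : ℕ => ((1 / (n : ℝ) * condMutualInfo (S.disc n).law (S.disc n).transcript
    (S.disc n).allObsBlock (S.disc n).wtBlock : ℝ) : EReal)) atTop

/-- The minimum leakage rate for omniscience `R_L`. -/
def minLeakageRate (src : WiretapSource V) : EReal :=
  ⨅ S : OmniscienceScheme src, S.leakageRate

/-- A secret key agreement scheme: for every `n` a discussion, and a key in a set of `keySize n`
elements that with probability tending to `1` all users output, such that
`log |K^(n)| - H(K^(n) | F^(n), Z_w^n)`, which is never negative, tends to `0`. -/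
structure KeyScheme (src : WiretapSource V) where
  disc : ∀ n, Discussion src n
  keySize : ℕ → ℕ
  outputs : ∀ n, (disc n).Outputs (Fin (keySize n))
  key : ∀ n, (disc n).Sample → Fin (keySize n)
  key_measurable : ∀ n k, MeasurableSet (key n ⁻¹' {k})
  recoverability : Tendsto (fun n => (disc n).law.real
    {ω | ∀ i, (outputs n).eval i ω = key n ω}) atTop (𝓝 1)
  secrecy : Tendsto (fun n => Real.logb 2 (keySize n) - condEntropy (disc n).law (key n)
    (fun ω => ((disc n).transcript ω, (disc n).wtBlock ω))) atTop (𝓝 0)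

/-- The key rate `liminf (1/n) log |K^(n)|` of a secret key agreement scheme. -/
def KeyScheme.rate {src : WiretapSource V} (S : KeyScheme src) : EReal :=
  liminf (fun n : ℕ => ((1 / (n : ℝ) * Real.logb 2 (S.keySize n) : ℝ) : EReal)) atTop

/-- The wiretap secret key capacity `C_W`. -/
def wiretapKeyCapacity (src : WiretapSource V) : EReal :=
  ⨆ S : KeyScheme src, S.rate

end Capacities

/-! ### Tree-PIN sources with linear wiretapper -/

section Tree

variable {V : Type} [Finite V] (T : SimpleGraph V) [Fintype T.edgeSet] {F : Type} [Field F] [Finite F]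
  (len : T.edgeSet → ℕ)

/-- The values of `Z_i = (Y_e : i ∈ ξ(e))`, where `Y_e` is a vector of length `len e`. -/
abbrev VertexObs {V : Type} (T : SimpleGraph V) (len : T.edgeSet → ℕ) (F : Type) (i : V) : Type :=
  ∀ e : {e : T.edgeSet // i ∈ (e : Sym2 V)}, Fin (len e.1) → F

open Classical in
/-- The tree-PIN source with linear wiretapper. The base vector `X = (X_{e,k})` consists of i.i.d.
uniform elements of `F`, that is, it is a uniform vector; `Z_i` consists of the `X_{e,k}` with `e`
incident to `i`, and `Z_w = X W`. -/
def treeSource {nw : ℕ} (W : Matrix (Σ e : T.edgeSet, Fin (len e)) (Fin nw) F) :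
    WiretapSource V where
  Base := (Σ e : T.edgeSet, Fin (len e)) → F
  law := @PMF.uniformOfFintype ((Σ e : T.edgeSet, Fin (len e)) → F) (Fintype.ofFinite _) _
  Obs := VertexObs T len F
  obs _ x := fun e k => x ⟨e.1, k⟩
  Wt := Fin nw → F
  wt x := Matrix.vecMul x W

/-- The random vector `Y_e = (X_{e,1}, …, X_{e,n_e})`. -/
def edgeVector {nw : ℕ} (W : Matrix (Σ e : T.edgeSet, Fin (len e)) (Fin nw) F) (e : T.edgeSet) :
    (treeSource T len W).Base → (Fin (len e) → F) :=
  fun x k => x ⟨e, k⟩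

/-- The one-round discussion, without private randomness, in which user `i` sends a linear function
of `Z_i^n`. -/
def linearDiscussion {nw : ℕ} (W : Matrix (Σ e : T.edgeSet, Fin (len e)) (Fin nw) F) (n : ℕ)
    (d : V → ℕ) (L : ∀ i, (Fin n → VertexObs T len F i) →ₗ[F] (Fin (d i) → F)) :
    Discussion (treeSource T len W) n where
  Rand _ := Unit
  randLaw _ := Measure.dirac ()
  rounds := 1
  Msg _ i := Fin (d i) → F
  send _ i z _ _ := L i z
  send_measurable _ _ _ _ _ := .of_discrete

variable {T len} in
/-- The discussion is linear and non-interactive. -/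
def IsLinearNonInteractive {nw : ℕ} {W : Matrix (Σ e : T.edgeSet, Fin (len e)) (Fin nw) F} {n : ℕ}
    (D : Discussion (treeSource T len W) n) : Prop :=
  ∃ (d : V → ℕ) (L : ∀ i, (Fin n → VertexObs T len F i) →ₗ[F] (Fin (d i) → F)),
    D = linearDiscussion T len W n d L

end Tree

end TreePIN

end

open TreePIN

/-!
# Wiretap secret key capacity and minimum leakage rate of tree-PIN sources

Write `N` for the total number of symbols `X_{e,k}`. For an edge `e`, the common linear function of
`Y_e` and `Z_w` is the quotient map by the sum `commonKernel W e` of the kernels of `x ↦ Y_e` and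
`x ↦ Z_w`. It is a maximal common function, and `H(Y_e | mcf(Y_e, Z_w)) = r_e log q`, where
`r_e = edgeSecrecy W e` is also the dimension of the projection to `Y_e` of the space of source
vectors invisible to the wiretapper (`condEntropy_edgeVector`, `finrank_inf_add_edgeSecrecy`). Put
`s = min_e r_e`.

*Converse.* Both converses are instances of one bound, `Discussion.Outputs.condEntropy_le`: if after
a discussion `F` all users know `K` up to a small error probability, then
`H(K | F, Z_w^n) ≤ n r_e log q` for every edge `e`, up to the error terms of Fano's inequality.
Indeed `Z_w` may be replaced by the common function `J`, and `H(K | F, J^n) ≤ H(Y_e^n | J^n) + H(K | F, Y_e^n)`.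
Removing `e` from the tree splits the users into two groups. Given `Y_e^n` the two groups are independent, and they remain
so given `F`, because the set of sample points with a given transcript is a product set. As both groups
know `K`, the last term is small by Fano's inequality (`condEntropy_le_fano`). Taking for `K` the key
bounds `C_W`; taking `K = Z_V^n` bounds `H(Z_V^n | F, Z_w^n)`, hence the leakage, which equals
`n (N - n_w) log q - H(Z_V^n | F, Z_w^n)` (`condMutualInfo_eq`).

*Achievability.* Among the source blocks of length `n` that are invisible to the wiretapper, choose
a subspace `P` of dimension `n s - |E|` every element of which is determined by each single edge;
it exists by counting points (`exists_submodule_disjoint`, `exists_invisible_submodule`). User `i`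
sends its observation modulo the image of `P`. Neighbours share an edge, so these messages
determine the source block modulo `P` exactly (`mem_of_forall_vertexMap_mem`), and then every user
recovers the block. Since `P` is invisible to the wiretapper, `Z_w^n` is a function of the
communication. So the block is uniform on a coset of `P` for the wiretapper: the leakage is
`(n (N - n_w) - dim P) log q`, and a linear coordinate on `P` is a perfect key of `dim P` symbols.
-/

open MeasureTheory Filter Topology

noncomputable section

namespace TreePIN

/-! ### Shannon inequalities -/

section Shannon

variable {Ω : Type*} [MeasurableSpace Ω] {μ : Measure Ω} {α β δ : Type*}

/-- All fibres of `X` are measurable. For finite-valued `X` this is measurability with respect to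
the discrete structure on the alphabet; the alphabets of `Discussion` carry no `MeasurableSpace`
instance. -/
def FiberMeasurable (X : Ω → α) : Prop := ∀ a, MeasurableSet (X ⁻¹' {a})

theorem FiberMeasurable.preimage [Finite α] {X : Ω → α} (hX : FiberMeasurable X) (s : Set α) :
    MeasurableSet (X ⁻¹' s) := by
  rw [← Set.biUnion_preimage_singleton]
  exact .biUnion s.to_countable fun a _ => hX a

theorem FiberMeasurable.comp [Finite α] {X : Ω → α} (hX : FiberMeasurable X) (f : α → β) :
    FiberMeasurable (fun ω => f (X ω)) := fun b => hX.preimage (f ⁻¹' {b})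

theorem FiberMeasurable.prodMk {X : Ω → α} {Y : Ω → β} (hX : FiberMeasurable X)
    (hY : FiberMeasurable Y) : FiberMeasurable (fun ω => (X ω, Y ω)) := by
  rintro ⟨a, b⟩
  convert (hX a).inter (hY b) using 1
  ext ω
  simp

theorem FiberMeasurable.sum_preimage [IsFiniteMeasure μ] [Fintype α] {X : Ω → α}
    (hX : FiberMeasurable X) (s : Set α) [DecidablePred (· ∈ s)] :
    μ.real (X ⁻¹' s) = ∑ a, if a ∈ s then μ.real (X ⁻¹' {a}) else 0 := by
  rw [← Finset.sum_filter, ← measureReal_biUnion_finset]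
  · congr 1
    ext ω
    simp
  · intro a _ b _ hab
    exact Disjoint.preimage _ (by simpa using hab)
  · exact fun a _ => hX a

theorem FiberMeasurable.sum_eq_one [IsProbabilityMeasure μ] [Fintype α] {X : Ω → α}
    (hX : FiberMeasurable X) : ∑ a, μ.real (X ⁻¹' {a}) = 1 := by
  classical
  have := hX.sum_preimage (μ := μ) Set.univ
  simpa using this.symm

/-- The entropy of a function `f` of `X` is the expectation, over the law of `X`, of
`-log P(f(X))`. -/
theorem entropy_comp_eq_sum [IsFiniteMeasure μ] [Fintype α] [Finite β] {X : Ω → α}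
    (hX : FiberMeasurable X) (f : α → β) :
    entropy μ (fun ω => f (X ω)) = ∑ a, μ.real (X ⁻¹' {a}) *
      -Real.logb 2 (μ.real ((fun ω => f (X ω)) ⁻¹' {f a})) := by
  classical
  cases nonempty_fintype β
  rw [entropy, tsum_fintype, ← Finset.sum_fiberwise Finset.univ f]
  refine Finset.sum_congr rfl fun b _ => ?_
  have h : μ.real ((fun ω => f (X ω)) ⁻¹' {b}) = ∑ a with f a = b, μ.real (X ⁻¹' {a}) := by
    rw [Finset.sum_filter]
    exact hX.sum_preimage (f ⁻¹' {b})
  rw [← mul_neg]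
  conv_lhs => rw [h, Finset.sum_mul]
  refine Finset.sum_congr rfl fun a ha => ?_
  rw [(Finset.mem_filter.1 ha).2, ← h]

theorem entropy_eq_sum [IsFiniteMeasure μ] [Fintype α] {X : Ω → α} :
    entropy μ X = ∑ a, μ.real (X ⁻¹' {a}) * -Real.logb 2 (μ.real (X ⁻¹' {a})) := by
  rw [entropy, tsum_fintype]
  simp only [mul_neg]

theorem entropy_le_entropy_pair [IsFiniteMeasure μ] [Finite α] [Finite β] {X : Ω → α} {Y : Ω → β}
    (hX : FiberMeasurable X) (hY : FiberMeasurable Y) :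
    entropy μ X ≤ entropy μ (fun ω => (X ω, Y ω)) := by
  cases nonempty_fintype α
  cases nonempty_fintype β
  rw [entropy_comp_eq_sum (hX.prodMk hY) Prod.fst, entropy_eq_sum]
  refine Finset.sum_le_sum fun p _ => ?_
  have hle : μ.real ((fun ω => (X ω, Y ω)) ⁻¹' {p}) ≤ μ.real ((fun ω => X ω) ⁻¹' {p.1}) := by
    refine measureReal_mono ?_
    rintro ω rfl
    simp
  rcases eq_or_lt_of_le (measureReal_nonneg (μ := μ) (s := (fun ω => (X ω, Y ω)) ⁻¹' {p})) with h | h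
  · simp [← h]
  · refine mul_le_mul_of_nonneg_left (neg_le_neg ?_) h.le
    exact Real.logb_le_logb_of_le (by norm_num) h hle

theorem entropy_comp_le [IsFiniteMeasure μ] [Finite α] [Finite β] {X : Ω → α}
    (hX : FiberMeasurable X) (f : α → β) : entropy μ (fun ω => f (X ω)) ≤ entropy μ X := by
  refine (entropy_le_entropy_pair (hX.comp f) hX).trans_eq ?_
  exact entropy_relabel μ X (fun a => (f a, a)) fun a _ b _ h => (Prod.ext_iff.1 h).2

/-- Gibbs' inequality: coding `X` given `Y` with the wrong conditional law `Q` costs at least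
`H(X | Y)`. -/
theorem condEntropy_le_sum_logb [IsProbabilityMeasure μ] [Fintype α] [Fintype β] {X : Ω → α}
    {Y : Ω → β} (hX : FiberMeasurable X) (hY : FiberMeasurable Y) (Q : β → α → ℝ)
    (hQ0 : ∀ y x, 0 ≤ Q y x) (hQ1 : ∀ y, ∑ x, Q y x ≤ 1)
    (hpos : ∀ x y, 0 < μ.real ((fun ω => (X ω, Y ω)) ⁻¹' {(x, y)}) → 0 < Q y x) :
    condEntropy μ X Y ≤ ∑ p : α × β, μ.real ((fun ω => (X ω, Y ω)) ⁻¹' {p}) *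
      -Real.logb 2 (Q p.2 p.1) := by
  have hXY := hX.prodMk hY
  rw [condEntropy, entropy_comp_eq_sum hXY Prod.snd, entropy_eq_sum, ← Finset.sum_sub_distrib,
    ← sub_nonpos, ← Finset.sum_sub_distrib]
  have hlog : 0 < Real.log 2 := Real.log_pos (by norm_num)
  have key : ∀ p : α × β, μ.real ((fun ω => (X ω, Y ω)) ⁻¹' {p}) *
        -Real.logb 2 (μ.real ((fun ω => (X ω, Y ω)) ⁻¹' {p})) -
      μ.real ((fun ω => (X ω, Y ω)) ⁻¹' {p}) *
        -Real.logb 2 (μ.real ((fun ω => Y ω) ⁻¹' {p.2})) -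
      μ.real ((fun ω => (X ω, Y ω)) ⁻¹' {p}) * -Real.logb 2 (Q p.2 p.1) ≤
      (μ.real (Y ⁻¹' {p.2}) * Q p.2 p.1 - μ.real ((fun ω => (X ω, Y ω)) ⁻¹' {p})) / Real.log 2 := by
    rintro ⟨x, y⟩
    set a := μ.real ((fun ω => (X ω, Y ω)) ⁻¹' {(x, y)}) with ha
    set b := μ.real (Y ⁻¹' {y}) with hb
    rcases eq_or_lt_of_le (measureReal_nonneg (μ := μ)
      (s := (fun ω => (X ω, Y ω)) ⁻¹' {(x, y)})) with h | h
    · have h0 : a = 0 := h.symm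
      rw [h0]
      simp only [zero_mul, sub_zero]
      have : 0 ≤ b := measureReal_nonneg
      have := hQ0 y x
      positivity
    · have hab : a ≤ b := by
        refine measureReal_mono ?_
        intro ω hω
        exact (Prod.ext_iff.1 hω).2
      have hb0 : 0 < b := h.trans_le hab
      have hq := hpos x y h
      have h1 := Real.log_le_sub_one_of_pos (div_pos (mul_pos hb0 hq) h)
      rw [Real.log_div (by positivity) (ne_of_gt h), Real.log_mul hb0.ne' hq.ne'] at h1
      rw [le_div_iff₀ hlog]
      simp only [Real.logb]
      have h2 : (a * -(Real.log a / Real.log 2) - a * -(Real.log b / Real.log 2) -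
          a * -(Real.log (Q y x) / Real.log 2)) * Real.log 2 =
          a * (Real.log b + Real.log (Q y x) - Real.log a) := by
        field_simp
        ring
      change (a * -(Real.log a / Real.log 2) - a * -(Real.log b / Real.log 2) -
          a * -(Real.log (Q y x) / Real.log 2)) * Real.log 2 ≤ b * Q y x - a
      rw [h2]
      refine (mul_le_mul_of_nonneg_left h1 h.le).trans_eq ?_
      rw [← ha]
      have : a ≠ 0 := h.ne'
      field_simp
  refine (Finset.sum_le_sum fun p _ => key p).trans ?_
  rw [← Finset.sum_div, Finset.sum_sub_distrib, hXY.sum_eq_one]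
  refine div_nonpos_of_nonpos_of_nonneg (sub_nonpos.2 ?_) hlog.le
  rw [Fintype.sum_prod_type_right]
  calc ∑ y, ∑ x, μ.real (Y ⁻¹' {y}) * Q y x ≤ ∑ y, μ.real (Y ⁻¹' {y}) := by
        refine Finset.sum_le_sum fun y _ => ?_
        rw [← Finset.mul_sum]
        exact mul_le_of_le_one_right measureReal_nonneg (hQ1 y)
    _ = 1 := hY.sum_eq_one

/-- Conditioning reduces entropy. -/
theorem condEntropy_pair_le [IsProbabilityMeasure μ] [Finite α] [Finite β] [Finite δ] {X : Ω → α}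
    {Y : Ω → β} {Z : Ω → δ} (hX : FiberMeasurable X) (hY : FiberMeasurable Y)
    (hZ : FiberMeasurable Z) :
    condEntropy μ X (fun ω => (Y ω, Z ω)) ≤ condEntropy μ X Z := by
  classical
  cases nonempty_fintype α
  cases nonempty_fintype β
  cases nonempty_fintype δ
  have hYZ := hY.prodMk hZ
  have hXZ := hX.prodMk hZ
  have hXYZ := hX.prodMk hYZ
  have hle : ∀ p : α × β × δ, μ.real ((fun ω => (X ω, Y ω, Z ω)) ⁻¹' {p}) ≤
      μ.real ((fun ω => (X ω, Z ω)) ⁻¹' {(p.1, p.2.2)}) := by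
    intro p
    refine measureReal_mono ?_
    rintro ω rfl
    simp
  have hle' : ∀ p : α × δ, μ.real ((fun ω => (X ω, Z ω)) ⁻¹' {p}) ≤
      μ.real (Z ⁻¹' {p.2}) := by
    intro p
    refine measureReal_mono ?_
    rintro ω rfl
    simp
  refine (condEntropy_le_sum_logb hX hYZ
    (fun yz x => μ.real ((fun ω => (X ω, Z ω)) ⁻¹' {(x, yz.2)}) / μ.real (Z ⁻¹' {yz.2}))
    (fun yz x => by positivity) ?_ ?_).trans ?_
  · rintro ⟨y, z⟩
    rw [← Finset.sum_div]
    refine div_le_one_of_le₀ (le_of_eq ?_) measureReal_nonneg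
    have := hXZ.sum_preimage (μ := μ) (Prod.snd ⁻¹' {z})
    rw [Fintype.sum_prod_type] at this
    simp only [Set.mem_preimage, Set.mem_singleton_iff, Finset.sum_ite_eq', Finset.mem_univ,
      if_true] at this
    exact this.symm
  · intro x yz h
    exact div_pos (h.trans_le (hle _)) ((h.trans_le (hle _)).trans_le (hle' _))
  · rw [condEntropy, entropy_comp_eq_sum hXYZ (fun p => (p.1, p.2.2)),
      entropy_comp_eq_sum hXYZ (fun p => p.2.2), ← Finset.sum_sub_distrib]
    refine Finset.sum_le_sum fun p _ => le_of_eq ?_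
    rcases eq_or_lt_of_le (measureReal_nonneg (μ := μ)
      (s := (fun ω => (X ω, Y ω, Z ω)) ⁻¹' {p})) with h | h
    · rw [← h]
      simp
    · rw [Real.logb_div (h.trans_le (hle _)).ne' ((h.trans_le (hle _)).trans_le (hle' _)).ne']
      ring

/-- Fano's inequality. -/
theorem condEntropy_le_fano [IsProbabilityMeasure μ] [Finite α] {X Y : Ω → α}
    (hX : FiberMeasurable X) (hY : FiberMeasurable Y) :
    condEntropy μ X Y ≤ 1 + μ.real {ω | X ω ≠ Y ω} * Real.logb 2 (Nat.card α) := by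
  classical
  cases nonempty_fintype α
  have hXY := hX.prodMk hY
  obtain ⟨ω₀⟩ := nonempty_of_isProbabilityMeasure μ
  have : Nonempty α := ⟨X ω₀⟩
  have hc : (0 : ℝ) < Fintype.card α := by exact_mod_cast Fintype.card_pos
  have h0 : ∀ y x : α, (0 : ℝ) < (if x = y then 1 / 2 else 0) + 1 / (2 * Fintype.card α) := by
    intro y x
    split_ifs <;> positivity
  -- Guess `X = Y` with weight one half and a uniform value with weight one half.
  refine (condEntropy_le_sum_logb hX hY
    (fun y x => (if x = y then 1 / 2 else 0) + 1 / (2 * Fintype.card α))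
    (fun y x => (h0 y x).le) ?_ (fun x y _ => h0 y x)).trans ?_
  · intro y
    rw [Finset.sum_add_distrib]
    simp only [Finset.sum_ite_eq', Finset.mem_univ, if_true, Finset.sum_const, Finset.card_univ,
      nsmul_eq_mul]
    apply le_of_eq
    field_simp
    norm_num
  · have h1 : μ.real {ω | X ω ≠ Y ω} = ∑ p : α × α, if p.1 ≠ p.2 then
        μ.real ((fun ω => (X ω, Y ω)) ⁻¹' {p}) else 0 :=
      hXY.sum_preimage (μ := μ) {p | p.1 ≠ p.2}
    have h2 : 1 + μ.real {ω | X ω ≠ Y ω} * Real.logb 2 (Nat.card α) =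
        ∑ p : α × α, (μ.real ((fun ω => (X ω, Y ω)) ⁻¹' {p}) + (if p.1 ≠ p.2 then
          μ.real ((fun ω => (X ω, Y ω)) ⁻¹' {p}) else 0) * Real.logb 2 (Nat.card α)) := by
      rw [Finset.sum_add_distrib, hXY.sum_eq_one, ← Finset.sum_mul, h1]
    rw [h2]
    refine Finset.sum_le_sum fun p _ => ?_
    have hp : 0 ≤ μ.real ((fun ω => (X ω, Y ω)) ⁻¹' {p}) := measureReal_nonneg
    have hhalf : Real.logb 2 (1 / 2) = -1 := by
      rw [one_div, Real.logb_inv, Real.logb_self_eq_one (by norm_num)]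
    by_cases h : p.1 = p.2
    · rw [if_pos h, if_neg (not_not.2 h), zero_mul, add_zero]
      refine mul_le_of_le_one_right hp ?_
      rw [neg_le, ← hhalf]
      exact Real.logb_le_logb_of_le (by norm_num) (by norm_num)
        (le_add_of_nonneg_right (by positivity))
    · rw [if_neg h, if_pos h, zero_add, one_div, mul_inv,
        Real.logb_mul (by norm_num) (by positivity), Real.logb_inv,
        Real.logb_inv, Real.logb_self_eq_one (by norm_num), Nat.card_eq_fintype_card]
      apply le_of_eq
      ring

/-- If `X` and `Y` are conditionally independent given `Z`, then `Y` does not help to describe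
`X` given `Z`. -/
theorem condEntropy_le_of_condIndep [IsProbabilityMeasure μ] [Finite α] [Finite β] [Finite δ]
    {X : Ω → α} {Y : Ω → β} {Z : Ω → δ} (hX : FiberMeasurable X) (hY : FiberMeasurable Y)
    (hZ : FiberMeasurable Z)
    (h : ∀ x y z, μ.real {ω | X ω = x ∧ Y ω = y ∧ Z ω = z} * μ.real {ω | Z ω = z} =
      μ.real {ω | X ω = x ∧ Z ω = z} * μ.real {ω | Y ω = y ∧ Z ω = z}) :
    condEntropy μ X Z ≤ condEntropy μ X (fun ω => (Y ω, Z ω)) := by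
  cases nonempty_fintype α
  cases nonempty_fintype β
  cases nonempty_fintype δ
  have hXYZ := hX.prodMk (hY.prodMk hZ)
  rw [condEntropy, condEntropy, entropy_comp_eq_sum hXYZ (fun p => (p.1, p.2.2)),
    entropy_comp_eq_sum hXYZ (fun p => p.2.2), entropy_comp_eq_sum hXYZ (fun p => p.2),
    entropy_eq_sum, ← Finset.sum_sub_distrib, ← Finset.sum_sub_distrib]
  refine Finset.sum_le_sum fun p _ => le_of_eq ?_
  obtain ⟨x, y, z⟩ := p
  have e1 : (fun ω => (X ω, Y ω, Z ω)) ⁻¹' {(x, y, z)} = {ω | X ω = x ∧ Y ω = y ∧ Z ω = z} := by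
    ext; simp
  have e2 : (fun ω => (X ω, Z ω)) ⁻¹' {(x, z)} = {ω | X ω = x ∧ Z ω = z} := by ext; simp
  have e3 : (fun ω => (Y ω, Z ω)) ⁻¹' {(y, z)} = {ω | Y ω = y ∧ Z ω = z} := by ext; simp
  have e4 : (fun ω => Z ω) ⁻¹' {z} = {ω | Z ω = z} := by ext; simp
  simp only [e1, e2, e3, e4]
  have h := h x y z
  rcases eq_or_lt_of_le (measureReal_nonneg (μ := μ)
      (s := {ω | X ω = x ∧ Y ω = y ∧ Z ω = z})) with h0 | h0
  · rw [← h0]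
    simp
  · have p2 := h0.trans_le (measureReal_mono (μ := μ)
      (show {ω | X ω = x ∧ Y ω = y ∧ Z ω = z} ⊆ {ω | X ω = x ∧ Z ω = z} from fun ω h => ⟨h.1, h.2.2⟩))
    have p3 := h0.trans_le (measureReal_mono (μ := μ)
      (show {ω | X ω = x ∧ Y ω = y ∧ Z ω = z} ⊆ {ω | Y ω = y ∧ Z ω = z} from fun ω h => h.2))
    have p4 := h0.trans_le (measureReal_mono (μ := μ)
      (show {ω | X ω = x ∧ Y ω = y ∧ Z ω = z} ⊆ {ω | Z ω = z} from fun ω h => h.2.2))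
    have := congrArg (Real.logb 2) h
    rw [Real.logb_mul h0.ne' p4.ne', Real.logb_mul p2.ne' p3.ne'] at this
    rw [← mul_sub, ← mul_sub]
    congr 1
    linarith

end Shannon

/-! ### The law of a discussion -/

instance {V : Type} (src : WiretapSource V) : DiscreteMeasurableSpace src.Base :=
  ⟨fun _ => trivial⟩

instance {V : Type} (src : WiretapSource V) : IsProbabilityMeasure src.baseLaw :=
  inferInstanceAs (IsProbabilityMeasure src.law.toMeasure)

/-- The source can be cut, at the variable `Y`, into the users in `A` and the other users: two
realizations of the base that agree on `Y` can be recombined by `σ` into one whose users in `A` are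
those of the first and whose other users are those of the second. For a base with uniform law this
makes the two groups of users conditionally independent given `Y`. -/
structure WiretapSource.IsCut {V : Type} {υ : Type*} (src : WiretapSource V) (A : Set V)
    (Y : src.Base → υ) (σ : src.Base → src.Base → src.Base) : Prop where
  uniform : ∀ x x', src.baseLaw.real {x} = src.baseLaw.real {x'}
  swap_swap : ∀ x x', σ (σ x x') (σ x' x) = x
  cut_eq : ∀ x x', Y (σ x x') = Y x
  obs_mem : ∀ x x', ∀ i ∈ A, src.obs i (σ x x') = src.obs i x
  obs_notMem : ∀ x x', Y x = Y x' → ∀ i ∉ A, src.obs i (σ x x') = src.obs i x'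

namespace Discussion

section Measurability

variable {V : Type} {src : WiretapSource V} {n : ℕ} (D : Discussion src n)

/-- `D.Consistent i z r t h` says that in the first `t` rounds the messages of user `i` recorded in
`h` are those that user `i` sends, given the observations `z` and the private randomness `r`, when
`h` is the communication. -/
def Consistent (i : V) (z : Fin n → src.Obs i) (r : D.Rand i) : ∀ t, History D.Msg t → Prop
  | 0, _ => True
  | t + 1, h => Consistent i z r t h.1 ∧ D.send t i z r h.1 = h.2 i

/-- Transcripts are rectangular: given the observations, the event that the communication is `h` is
a product of events on the private randomness of the single users. -/
theorem history_eq_iff (ω : D.Sample) (t : ℕ) (h : History D.Msg t) :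
    D.history ω t = h ↔ ∀ i, D.Consistent i (D.obsBlock i ω) (ω.2 i) t h := by
  induction t with
  | zero => exact ⟨fun _ _ => trivial, fun _ => rfl⟩
  | succ t ih =>
    obtain ⟨h, m⟩ := h
    refine Iff.trans Prod.ext_iff ?_
    change _ ↔ ∀ i, D.Consistent i _ _ t h ∧ D.send t i _ _ h = m i
    rw [forall_and, ← ih h]
    refine and_congr_right fun hh => ?_
    change D.history ω t = h at hh
    rw [← hh]
    exact funext_iff

theorem measurableSet_consistent (i : V) (z : Fin n → src.Obs i) (t : ℕ) (h : History D.Msg t) :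
    MeasurableSet {r | D.Consistent i z r t h} := by
  induction t with
  | zero => exact MeasurableSet.univ
  | succ t ih => exact (ih h.1).inter (D.send_measurable t i z h.1 (h.2 i))

theorem measurableSet_of_forall_base {Q : D.Sample → Prop}
    (hQ : ∀ x, MeasurableSet {r | Q (x, r)}) : MeasurableSet {ω | Q ω} := by
  have : {ω | Q ω} = ⋃ x : Fin n → src.Base, {x} ×ˢ {r | Q (x, r)} := by
    ext ⟨x, r⟩
    simp
  rw [this]
  exact .iUnion fun x => (measurableSet_singleton x).prod (hQ x)

theorem fiberMeasurable_base {β : Type*} (g : (Fin n → src.Base) → β) :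
    FiberMeasurable (fun ω : D.Sample => g ω.1) := fun b =>
  D.measurableSet_of_forall_base (Q := fun ω => g ω.1 = b) fun x => .const (g x = b)

theorem measurableSet_forall_rand [Finite V] (x : Fin n → src.Base)
    {C : ∀ i, (Fin n → src.Obs i) → Set (D.Rand i)} (hC : ∀ i z, MeasurableSet (C i z)) :
    MeasurableSet {r : ∀ i, D.Rand i | ∀ i, r i ∈ C i fun t => src.obs i (x t)} := by
  have : {r : ∀ i, D.Rand i | ∀ i, r i ∈ C i fun t => src.obs i (x t)} =
      Set.univ.pi fun i => C i fun t => src.obs i (x t) := by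
    ext r
    simp
  rw [this]
  exact .univ_pi fun i => hC i _

theorem fiberMeasurable_transcript [Finite V] : FiberMeasurable D.transcript := by
  intro f
  refine D.measurableSet_of_forall_base fun x => ?_
  refine (D.measurableSet_forall_rand x (C := fun i z => {r | D.Consistent i z r D.rounds f})
    fun i z => D.measurableSet_consistent i z _ f).congr ?_
  ext r
  exact (D.history_eq_iff (x, r) D.rounds f).symm

theorem Outputs.fiberMeasurable_eval [Finite V] {D : Discussion src n} {α : Type}
    (E : D.Outputs α) (i : V) : FiberMeasurable (E.eval i) := by
  intro u
  have : E.eval i ⁻¹' {u} = ⋃ f, D.transcript ⁻¹' {f} ∩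
      {ω | E.out i (D.obsBlock i ω) (ω.2 i) f = u} := by
    ext ω
    simp [Outputs.eval]
  rw [this]
  refine .iUnion fun f => (D.fiberMeasurable_transcript f).inter ?_
  refine D.measurableSet_of_forall_base fun x => ?_
  exact measurable_pi_apply i (E.out_measurable i (fun t => src.obs i (x t)) f u)

end Measurability

section Law

variable {V : Type} [Fintype V] {src : WiretapSource V} {n : ℕ} (D : Discussion src n)

instance : IsProbabilityMeasure D.law := by
  unfold law
  infer_instance

theorem law_real_base (s : Set (Fin n → src.Base)) :
    D.law.real {ω | ω.1 ∈ s} = (Measure.pi fun _ : Fin n => src.baseLaw).real s := by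
  have : {ω : D.Sample | ω.1 ∈ s} = s ×ˢ Set.univ := by ext; simp
  rw [this, measureReal_def, law, Measure.prod_prod, measure_univ, mul_one, measureReal_def]

open Classical in
theorem law_real_rectangle [Fintype src.Base] (P : (Fin n → src.Base) → Prop)
    (C : ∀ i, (Fin n → src.Obs i) → Set (D.Rand i)) :
    D.law.real {ω | P ω.1 ∧ ∀ i, ω.2 i ∈ C i (D.obsBlock i ω)} =
      ∑ x, if P x then (∏ t, src.baseLaw.real {x t}) *
        ∏ i, (D.randLaw i).real (C i fun t => src.obs i (x t)) else 0 := by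
  have h1 := (D.fiberMeasurable_base id).sum_preimage (μ := D.law.restrict
    {ω | P ω.1 ∧ ∀ i, ω.2 i ∈ C i (D.obsBlock i ω)}) Set.univ
  simp only [Set.preimage_univ, measureReal_restrict_apply_univ, Set.mem_univ, if_true] at h1
  rw [h1]
  refine Finset.sum_congr rfl fun x _ => ?_
  rw [measureReal_restrict_apply (D.fiberMeasurable_base id x)]
  by_cases hx : P x
  · have : (fun ω : D.Sample => id ω.1) ⁻¹' {x} ∩
        {ω | P ω.1 ∧ ∀ i, ω.2 i ∈ C i (D.obsBlock i ω)} =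
        (Set.univ.pi fun t => {x t}) ×ˢ (Set.univ.pi fun i => C i fun t => src.obs i (x t)) := by
      ext ⟨x', r⟩
      simp only [id, Set.mem_inter_iff, Set.mem_preimage, Set.mem_singleton_iff, Set.mem_ofPred_eq,
        Set.mem_prod, Set.mem_univ_pi, ← funext_iff]
      constructor
      · rintro ⟨rfl, -, h⟩
        exact ⟨rfl, h⟩
      · rintro ⟨rfl, h⟩
        exact ⟨rfl, hx, h⟩
    rw [if_pos hx, this, measureReal_def, law, Measure.prod_prod, Measure.pi_pi, Measure.pi_pi,
      ENNReal.toReal_mul, ENNReal.toReal_prod, ENNReal.toReal_prod]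
    rfl
  · have : (fun ω : D.Sample => id ω.1) ⁻¹' {x} ∩
        {ω | P ω.1 ∧ ∀ i, ω.2 i ∈ C i (D.obsBlock i ω)} = ∅ := by
      ext ω
      simp only [id, Set.mem_inter_iff, Set.mem_preimage, Set.mem_singleton_iff, Set.mem_ofPred_eq,
        Set.mem_empty_iff_false, iff_false, not_and]
      rintro rfl h
      exact absurd h hx
    rw [if_neg hx, this, measureReal_empty]

variable {D} in
open Classical in
theorem law_real_mul_law_real {υ : Type*} {A : Set V}
    {Y : src.Base → υ} {σ : src.Base → src.Base → src.Base} (hσ : src.IsCut A Y σ)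
    (y : Fin n → υ) (C C' : ∀ i, (Fin n → src.Obs i) → Set (D.Rand i)) :
    D.law.real {ω | (∀ t, Y (ω.1 t) = y t) ∧ ∀ i, ω.2 i ∈ C i (D.obsBlock i ω)} *
        D.law.real {ω | (∀ t, Y (ω.1 t) = y t) ∧ ∀ i, ω.2 i ∈ C' i (D.obsBlock i ω)} =
      D.law.real {ω | (∀ t, Y (ω.1 t) = y t) ∧
          ∀ i, ω.2 i ∈ if i ∈ A then C i (D.obsBlock i ω) else C' i (D.obsBlock i ω)} *
        D.law.real {ω | (∀ t, Y (ω.1 t) = y t) ∧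
          ∀ i, ω.2 i ∈ if i ∈ A then C' i (D.obsBlock i ω) else C i (D.obsBlock i ω)} := by
  cases nonempty_fintype src.Base
  simp only [D.law_real_rectangle (fun x => ∀ t, Y (x t) = y t) C,
    D.law_real_rectangle (fun x => ∀ t, Y (x t) = y t) C',
    D.law_real_rectangle (fun x => ∀ t, Y (x t) = y t) fun i z => if i ∈ A then C i z else C' i z,
    D.law_real_rectangle (fun x => ∀ t, Y (x t) = y t) fun i z => if i ∈ A then C' i z else C i z,
    Finset.sum_mul_sum, Finset.sum_mul_sum, ← Finset.sum_product', ← Finset.sum_product']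
  -- Exchanging the halves of a pair of realizations is an involution.
  let τ : (Fin n → src.Base) × (Fin n → src.Base) → (Fin n → src.Base) × (Fin n → src.Base) :=
    fun p => (fun t => σ (p.1 t) (p.2 t), fun t => σ (p.2 t) (p.1 t))
  have hτ : Function.Involutive τ := fun p =>
    Prod.ext (funext fun t => hσ.swap_swap _ _) (funext fun t => hσ.swap_swap _ _)
  refine Finset.sum_equiv hτ.toPerm (by simp) ?_
  rintro ⟨x, x'⟩ -
  simp only [Function.Involutive.coe_toPerm, τ, hσ.cut_eq]
  by_cases h : ∀ t, Y (x t) = y t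
  · by_cases h' : ∀ t, Y (x' t) = y t
    · rw [if_pos h, if_pos h', if_pos h, if_pos h']
      rw [mul_mul_mul_comm, mul_mul_mul_comm _ _ (∏ t, src.baseLaw.real _) _]
      congr 1
      · congr 1 <;> exact Finset.prod_congr rfl fun t _ => hσ.uniform _ _
      · rw [← Finset.prod_mul_distrib, ← Finset.prod_mul_distrib]
        refine Finset.prod_congr rfl fun i _ => ?_
        by_cases hi : i ∈ A
        · simp only [if_pos hi, hσ.obs_mem _ _ i hi]
        · have e1 : ∀ t, src.obs i (σ (x t) (x' t)) = src.obs i (x' t) := fun t =>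
            hσ.obs_notMem _ _ ((h t).trans (h' t).symm) i hi
          have e2 : ∀ t, src.obs i (σ (x' t) (x t)) = src.obs i (x t) := fun t =>
            hσ.obs_notMem _ _ ((h' t).trans (h t).symm) i hi
          simp only [if_neg hi, e1, e2]
          exact mul_comm _ _
    · rw [if_neg h', if_neg h', mul_zero, mul_zero]
  · rw [if_neg h, if_neg h, zero_mul, zero_mul]

/-- The outputs of users on different sides of a cut are conditionally independent given the
communication and the cut variable. -/
theorem Outputs.condIndep_eval {D : Discussion src n} {υ α : Type} {A : Set V}
    {Y : src.Base → υ} {σ : src.Base → src.Base → src.Base} (hσ : src.IsCut A Y σ)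
    (E : D.Outputs α) {a b : V} (ha : a ∈ A) (hb : b ∉ A) (u v : α)
    (w : D.Transcript × (Fin n → υ)) :
    D.law.real {ω | E.eval a ω = u ∧ E.eval b ω = v ∧
          (D.transcript ω, fun t => Y (ω.1 t)) = w} *
        D.law.real {ω | (D.transcript ω, fun t => Y (ω.1 t)) = w} =
      D.law.real {ω | E.eval a ω = u ∧ (D.transcript ω, fun t => Y (ω.1 t)) = w} *
        D.law.real {ω | E.eval b ω = v ∧ (D.transcript ω, fun t => Y (ω.1 t)) = w} := by
  classical
  obtain ⟨f, y⟩ := w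
  have hab : a ≠ b := fun h => hb (h ▸ ha)
  let C : Set α → Set α → ∀ i, (Fin n → src.Obs i) → Set (D.Rand i) := fun s s' i z =>
    {r | D.Consistent i z r D.rounds f ∧ (i = a → E.out i z r f ∈ s) ∧
      (i = b → E.out i z r f ∈ s')}
  have hset : ∀ s s', {ω : D.Sample | E.eval a ω ∈ s ∧ E.eval b ω ∈ s' ∧
      (D.transcript ω, fun t => Y (ω.1 t)) = (f, y)} =
      {ω | (∀ t, Y (ω.1 t) = y t) ∧ ∀ i, ω.2 i ∈ C s s' i (D.obsBlock i ω)} := by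
    intro s s'
    ext ω
    simp only [Set.mem_ofPred_eq, C, forall_and, Prod.mk.injEq, forall_eq, funext_iff]
    rw [← D.history_eq_iff]
    change _ ∧ _ ∧ D.transcript ω = f ∧ _ ↔ _ ∧ D.transcript ω = f ∧ _
    constructor
    · rintro ⟨h1, h2, rfl, h3⟩
      exact ⟨h3, rfl, h1, h2⟩
    · rintro ⟨h3, rfl, h1, h2⟩
      exact ⟨h1, h2, rfl, h3⟩
  have hmix : ∀ s s' q q' i z, (if i ∈ A then C s s' i z else C q q' i z) = C s q' i z := by
    intro s s' q q' i z
    ext r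
    by_cases hi : i ∈ A
    · have hib : i ≠ b := fun h => hb (h ▸ hi)
      simp [C, hi, hib]
    · have hia : i ≠ a := fun h => hi (h ▸ ha)
      simp [C, hi, hia]
  have key := law_real_mul_law_real (D := D) hσ y (C {u} {v}) (C Set.univ Set.univ)
  simp only [hmix, ← hset] at key
  simpa using key

/-- The converse bound. Up to the Fano terms, the uncertainty of the wiretapper about a variable that
all users know is at most the conditional entropy of a cut variable given any function of the
wiretapper's observation: given the communication and the cut variable, the two sides of the
cut are independent, so that whatever both know is almost determined. -/
theorem Outputs.condEntropy_le {D : Discussion src n} {υ ι α : Type} [Finite υ] [Finite ι]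
    {A : Set V} {Y : src.Base → υ} {σ : src.Base → src.Base → src.Base} (hσ : src.IsCut A Y σ)
    [Finite α] (E : D.Outputs α) {a b : V} (ha : a ∈ A) (hb : b ∉ A) (J : src.Wt → ι)
    {K : D.Sample → α} (hK : FiberMeasurable K) :
    condEntropy D.law K (fun ω => (D.transcript ω, D.wtBlock ω)) ≤
      condEntropy D.law (fun ω (t : Fin n) => Y (ω.1 t)) (fun ω (t : Fin n) => J (src.wt (ω.1 t))) +
        2 + 2 * (1 - D.law.real {ω | ∀ i, E.eval i ω = K ω}) * Real.logb 2 (Nat.card α) := by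
  have hF := D.fiberMeasurable_transcript
  have hY := D.fiberMeasurable_base fun x (t : Fin n) => Y (x t)
  have hJ := D.fiberMeasurable_base fun x (t : Fin n) => J (src.wt (x t))
  have hW : FiberMeasurable D.wtBlock := D.fiberMeasurable_base fun x (t : Fin n) => src.wt (x t)
  have hEa := E.fiberMeasurable_eval a
  have hEb := E.fiberMeasurable_eval b
  set Yn : D.Sample → Fin n → υ := fun ω t => Y (ω.1 t) with hYn
  set Jn : D.Sample → Fin n → ι := fun ω t => J (src.wt (ω.1 t)) with hJn
  set μ := D.law
  set F := D.transcript
  set Wn := D.wtBlock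
  have hlog : 0 ≤ Real.logb 2 (Nat.card α) := by
    rcases Nat.eq_zero_or_pos (Nat.card α) with h | h
    · simp [h]
    · exact Real.logb_nonneg (by norm_num) (by exact_mod_cast h)
  have hgood : MeasurableSet {ω | ∀ i, E.eval i ω = K ω} := by
    have : {ω | ∀ i, E.eval i ω = K ω} = ⋂ i, ⋃ u, E.eval i ⁻¹' {u} ∩ K ⁻¹' {u} := by
      ext ω
      simp [eq_comm]
    rw [this]
    exact .iInter fun i => .iUnion fun u => (E.fiberMeasurable_eval i u).inter (hK u)
  have herr : ∀ s : Set D.Sample, s ⊆ {ω | ∀ i, E.eval i ω = K ω}ᶜ →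
      μ.real s * Real.logb 2 (Nat.card α) ≤
        (1 - μ.real {ω | ∀ i, E.eval i ω = K ω}) * Real.logb 2 (Nat.card α) := by
    intro s hs
    refine mul_le_mul_of_nonneg_right ?_ hlog
    rw [← probReal_compl_eq_one_sub hgood]
    exact measureReal_mono hs
  have h1 : condEntropy μ K (fun ω => (F ω, Wn ω)) ≤ condEntropy μ K (fun ω => (F ω, Jn ω)) := by
    refine (le_of_eq ?_).trans (condEntropy_pair_le hK hW (hF.prodMk hJ))
    have e1 := entropy_relabel μ (fun ω => (F ω, Wn ω)) (fun p => (p.2, p.1, fun t => J (p.2 t)))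
      (by rintro ⟨p1, p2⟩ _ ⟨q1, q2⟩ _ h; simp at h; simp [h])
    have e2 := entropy_relabel μ (fun ω => (K ω, F ω, Wn ω))
      (fun p => (p.1, p.2.2, p.2.1, fun t => J (p.2.2 t)))
      (by rintro ⟨p0, p1, p2⟩ _ ⟨q0, q1, q2⟩ _ h; simp at h; simp [h])
    simp only [condEntropy]
    rw [← e1, ← e2]
    rfl
  have h2 : condEntropy μ K (fun ω => (F ω, Jn ω)) ≤
      condEntropy μ Yn (fun ω => (F ω, Jn ω)) + condEntropy μ K (fun ω => (Jn ω, F ω, Yn ω)) := by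
    have e1 := entropy_le_entropy_pair (μ := μ) (hK.prodMk (hF.prodMk hJ)) hY
    have e2 := entropy_relabel μ (fun ω => (K ω, Jn ω, F ω, Yn ω))
      (fun p => ((p.1, p.2.2.1, p.2.1), p.2.2.2))
      (by rintro ⟨p0, p1, p2, p3⟩ _ ⟨q0, q1, q2, q3⟩ _ h; simp at h; simp [h])
    have e3 := entropy_relabel μ (fun ω => (Jn ω, F ω, Yn ω))
      (fun p => (p.2.2, p.2.1, p.1))
      (by rintro ⟨p1, p2, p3⟩ _ ⟨q1, q2, q3⟩ _ h; simp at h; simp [h])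
    simp only [condEntropy]
    linarith
  have h3 : condEntropy μ Yn (fun ω => (F ω, Jn ω)) ≤ condEntropy μ Yn Jn :=
    condEntropy_pair_le hY hF hJ
  have h4 : condEntropy μ K (fun ω => (Jn ω, F ω, Yn ω)) ≤ condEntropy μ K (fun ω => (F ω, Yn ω)) :=
    condEntropy_pair_le hK hJ (hF.prodMk hY)
  have h5 : condEntropy μ K (fun ω => (F ω, Yn ω)) ≤
      condEntropy μ (E.eval a) (fun ω => (F ω, Yn ω)) +
        condEntropy μ K (fun ω => ((F ω, Yn ω), E.eval a ω)) := by
    have e1 := entropy_le_entropy_pair (μ := μ) (hK.prodMk (hF.prodMk hY)) hEa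
    have e2 := entropy_relabel μ (fun ω => (K ω, (F ω, Yn ω), E.eval a ω))
      (fun p => ((p.1, p.2.1), p.2.2))
      (by rintro ⟨p0, p1, p2⟩ _ ⟨q0, q1, q2⟩ _ h; simp at h; simp [h])
    have e3 := entropy_relabel μ (fun ω => ((F ω, Yn ω), E.eval a ω)) Prod.swap
      Prod.swap_injective.injOn
    simp only [condEntropy]
    simp only [Prod.swap] at e3
    linarith
  have h6 : condEntropy μ K (fun ω => ((F ω, Yn ω), E.eval a ω)) ≤
      1 + (1 - μ.real {ω | ∀ i, E.eval i ω = K ω}) * Real.logb 2 (Nat.card α) := by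
    refine (condEntropy_pair_le hK (hF.prodMk hY) hEa).trans
      ((condEntropy_le_fano hK hEa).trans (add_le_add le_rfl (herr _ ?_)))
    exact fun ω hω h => hω (h a).symm
  have h7 : condEntropy μ (E.eval a) (fun ω => (F ω, Yn ω)) ≤
      1 + (1 - μ.real {ω | ∀ i, E.eval i ω = K ω}) * Real.logb 2 (Nat.card α) := by
    refine (condEntropy_le_of_condIndep hEa hEb (hF.prodMk hY)
      (E.condIndep_eval hσ ha hb)).trans ?_
    have e2 := entropy_relabel μ (fun ω => (E.eval a ω, E.eval b ω, F ω, Yn ω))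
      (fun p => (p.1, p.2.2, p.2.1))
      (by rintro ⟨p0, p1, p2⟩ _ ⟨q0, q1, q2⟩ _ h; simp at h; simp [h])
    have e3 := entropy_relabel μ (fun ω => (E.eval b ω, F ω, Yn ω)) Prod.swap
      Prod.swap_injective.injOn
    have e4 : condEntropy μ (E.eval a) (fun ω => (E.eval b ω, F ω, Yn ω)) =
        condEntropy μ (E.eval a) (fun ω => ((F ω, Yn ω), E.eval b ω)) := by
      simp only [condEntropy]
      simp only [Prod.swap] at e3
      linarith
    rw [e4]
    refine (condEntropy_pair_le hEa (hF.prodMk hY) hEb).trans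
      ((condEntropy_le_fano hEa hEb).trans (add_le_add le_rfl (herr _ ?_)))
    exact fun ω hω h => hω ((h a).trans (h b).symm)
  linarith

end Law

end Discussion

/-! ### Linear functions of uniform vectors -/

section Linear

variable {F : Type*} [Field F] {M : Type*} [AddCommGroup M] [Module F M] [Finite M]

/-- A function of a uniform vector whose fibres are the cosets of the subspace `U` has entropy
`codim U * log q`. -/
theorem entropy_of_uniform [Finite F] {Ω β : Type*} [MeasurableSpace Ω] {μ : Measure Ω}
    [IsProbabilityMeasure μ] [Finite β] {X : Ω → M} (hX : FiberMeasurable X)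
    (hu : ∀ x y, μ.real (X ⁻¹' {x}) = μ.real (X ⁻¹' {y})) (U : Submodule F M) (g : M → β)
    (hg : ∀ x y, g x = g y ↔ x - y ∈ U) :
    entropy μ (fun ω => g (X ω)) =
      ((Module.finrank F M : ℝ) - Module.finrank F U) * Real.logb 2 (Nat.card F) := by
  classical
  cases nonempty_fintype M
  have hsum := hX.sum_eq_one (μ := μ)
  have hp : ∀ x, μ.real (X ⁻¹' {x}) = 1 / Nat.card M := by
    intro x
    have : (Nat.card M : ℝ) ≠ 0 := by exact_mod_cast Nat.card_pos.ne'
    rw [Finset.sum_congr rfl fun y _ => hu y x, Finset.sum_const, Finset.card_univ,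
      nsmul_eq_mul, ← Nat.card_eq_fintype_card] at hsum
    field_simp
    linarith
  have hfib : ∀ x, μ.real ((fun ω => g (X ω)) ⁻¹' {g x}) = Nat.card U / Nat.card M := by
    intro x
    have h := hX.sum_preimage (μ := μ) (g ⁻¹' {g x})
    rw [← Finset.sum_filter, Finset.sum_congr rfl fun y _ => hp y, Finset.sum_const,
      nsmul_eq_mul] at h
    have hc : (Finset.univ.filter (· ∈ g ⁻¹' {g x})).card = Nat.card U := by
      rw [← Fintype.card_subtype, ← Nat.card_eq_fintype_card]
      refine Nat.card_congr ⟨fun y => ⟨y - x, (hg _ _).1 y.2⟩,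
        fun u => ⟨u + x, (hg _ _).2 (by simp)⟩, fun y => by simp, fun u => by simp⟩
    rw [hc, mul_one_div] at h
    exact h
  have hF : (Nat.card F : ℝ) ≠ 0 := by exact_mod_cast Nat.card_pos.ne'
  rw [entropy_comp_eq_sum hX g, Finset.sum_congr rfl fun x _ => by rw [hfib x], ← Finset.sum_mul,
    hsum, one_mul, Module.natCard_eq_pow_finrank (K := F) (V := U),
    Module.natCard_eq_pow_finrank (K := F) (V := M)]
  push_cast
  rw [Real.logb_div (pow_ne_zero _ hF) (pow_ne_zero _ hF), Real.logb_pow, Real.logb_pow]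
  ring

/-- If `H(Y | X) = 0` then `Y` is a function of `X`, on the atoms of positive probability. -/
theorem eq_of_condEntropy_eq_zero {Ω α β : Type*} [MeasurableSpace Ω] [DiscreteMeasurableSpace Ω]
    [Finite Ω] {μ : Measure Ω} [IsProbabilityMeasure μ] [Finite α] [Finite β] (Y : Ω → β)
    (X : Ω → α) (h : condEntropy μ Y X = 0) (hμ : ∀ ω, 0 < μ.real {ω}) {ω ω' : Ω}
    (hω : X ω = X ω') : Y ω = Y ω' := by
  classical
  cases nonempty_fintype Ω
  have hid : FiberMeasurable (id : Ω → Ω) := fun _ => .of_discrete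
  rw [condEntropy] at h
  rw [show entropy μ (fun ω => (Y ω, X ω)) = _ from
    entropy_comp_eq_sum hid (fun ω => (Y ω, X ω)), show entropy μ X = _ from
    entropy_comp_eq_sum hid X, ← Finset.sum_sub_distrib, Finset.sum_eq_zero_iff_of_nonneg] at h
  · have h1 := h ω (Finset.mem_univ _)
    simp only [Set.preimage_id, id] at h1
    set S := (fun ω => (Y ω, X ω)) ⁻¹' {(Y ω, X ω)} with hS
    set R := (fun ω => X ω) ⁻¹' {X ω} with hR
    have hpS : 0 < μ.real S := (hμ ω).trans_le (measureReal_mono (by simp [hS]))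
    have hSR : S ⊆ R := fun x hx => (Prod.ext_iff.1 hx).2
    have hpR : 0 < μ.real R := hpS.trans_le (measureReal_mono hSR)
    have h2 : μ.real S = μ.real R := by
      refine Real.logb_injOn_pos (by norm_num : (1 : ℝ) < 2) hpS hpR ?_
      have := (hμ ω).ne'
      have h3 : μ.real {ω} * (Real.logb 2 (μ.real R) - Real.logb 2 (μ.real S)) = 0 := by
        linarith
      rcases mul_eq_zero.1 h3 with h4 | h4
      · exact absurd h4 this
      · linarith
    by_contra hne
    have h5 : {ω'} ⊆ R \ S := by
      rintro _ rfl
      refine ⟨by simp [hR, hω], fun hs => hne ?_⟩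
      exact (Prod.ext_iff.1 hs).1.symm
    have h6 := measureReal_sdiff (μ := μ) hSR (.of_discrete)
    have h7 := (hμ ω').trans_le (measureReal_mono (μ := μ) h5)
    linarith
  · intro x _
    rw [← mul_sub]
    refine mul_nonneg measureReal_nonneg (sub_nonneg.2 (neg_le_neg ?_))
    refine Real.logb_le_logb_of_le (by norm_num) ((hμ x).trans_le (measureReal_mono ?_))
      (measureReal_mono ?_)
    · simp
    · exact fun y hy => (Prod.ext_iff.1 hy).2

instance (U : Submodule F M) : Finite (M ⧸ U) := .of_surjective _ U.mkQ_surjective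

variable {N : Type*} [AddCommGroup N] [Module F N]

theorem finrank_ker_compLeft (L : M →ₗ[F] N) (n : ℕ) :
    Module.finrank F (LinearMap.ker (L.compLeft (Fin n))) =
      n * Module.finrank F (LinearMap.ker L) := by
  have h : LinearMap.ker (L.compLeft (Fin n)) =
      LinearMap.range ((LinearMap.ker L).subtype.compLeft (Fin n)) := by
    rw [LinearMap.ker_compLeft, LinearMap.range_compLeft, Submodule.range_subtype]
  rw [h, LinearMap.finrank_range_of_inj, Module.finrank_pi_fintype]
  · simp
  · exact fun x y hxy => funext fun t => Subtype.ext (congrFun hxy t)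

/-- In a space over a finite field, there is a subspace in general position with respect to
finitely many subspaces of codimension at least `d`, of dimension `d` up to a constant that
depends only on the number of subspaces. Greedily, a vector outside the sums `P ⊔ N e` is added to
`P`; it exists because these sums have too few points to cover the space. -/
theorem exists_submodule_disjoint [Finite F] {ι : Type*} [Fintype ι] [Nonempty ι] (N : ι → Submodule F M)
    (d : ℕ) (hd : ∀ e, Module.finrank F (N e) + d ≤ Module.finrank F M) :
    ∃ P : Submodule F M, Module.finrank F P = d - Fintype.card ι ∧ ∀ e, Disjoint P (N e) := by
  suffices ∀ m ≤ d - Fintype.card ι, ∃ P : Submodule F M, Module.finrank F P = m ∧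
      ∀ e, Disjoint P (N e) from this _ le_rfl
  intro m
  induction m with
  | zero => exact fun _ => ⟨⊥, by simp, fun e => disjoint_bot_left⟩
  | succ m ih =>
    intro hm
    obtain ⟨P, hP, hPN⟩ := ih (by omega)
    have hq : 1 < Nat.card F := Finite.one_lt_card
    obtain ⟨v, hv⟩ : ∃ v, ∀ e, v ∉ P ⊔ N e := by
      by_contra! hcon
      have hcover : (⋃ e, ((P ⊔ N e : Submodule F M) : Set M)) = Set.univ := by
        ext v
        simpa using hcon v
      have hcard : ∀ e, ((P ⊔ N e : Submodule F M) : Set M).ncard ≤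
          Nat.card F ^ (Module.finrank F M - Fintype.card ι) := by
        intro e
        have h1 : ((P ⊔ N e : Submodule F M) : Set M).ncard =
            Nat.card F ^ Module.finrank F (P ⊔ N e : Submodule F M) :=
          Module.natCard_eq_pow_finrank (K := F) (V := (P ⊔ N e : Submodule F M))
        rw [h1]
        refine Nat.pow_le_pow_right hq.le ?_
        have := Submodule.finrank_add_le_finrank_add_finrank P (N e)
        have := hd e
        omega
      have h1 : Nat.card M ≤
          Fintype.card ι * Nat.card F ^ (Module.finrank F M - Fintype.card ι) := by
        rw [← Set.ncard_univ, ← hcover]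
        calc (⋃ e, ((P ⊔ N e : Submodule F M) : Set M)).ncard
            ≤ ∑ e, ((P ⊔ N e : Submodule F M) : Set M).ncard := Set.ncard_iUnion_le_of_fintype _
          _ ≤ ∑ _e : ι, Nat.card F ^ (Module.finrank F M - Fintype.card ι) :=
            Finset.sum_le_sum fun e _ => hcard e
          _ = _ := by simp
      have h2 : Fintype.card ι ≤ Module.finrank F M := by
        have := hd (Classical.arbitrary ι)
        omega
      have h3 : Nat.card F ^ (Fintype.card ι) *
          Nat.card F ^ (Module.finrank F M - Fintype.card ι) = Nat.card M := by
        rw [← pow_add, Nat.add_sub_cancel' h2, Module.natCard_eq_pow_finrank (K := F) (V := M)]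
      have h4 : Fintype.card ι < Nat.card F ^ Fintype.card ι := Nat.lt_pow_self hq
      have h5 : 0 < Nat.card F ^ (Module.finrank F M - Fintype.card ι) :=
        pow_pos (by omega) _
      have := Nat.mul_lt_mul_of_pos_right h4 h5
      omega
    refine ⟨P ⊔ F ∙ v, ?_, fun e => ?_⟩
    · have hvP : v ∉ P := fun h => hv (Classical.arbitrary ι) (Submodule.mem_sup_left h)
      have hv0 : v ≠ 0 := fun h => hvP (h ▸ P.zero_mem)
      have h1 := Submodule.finrank_sup_add_finrank_inf_eq P (F ∙ v)
      have h2 : P ⊓ (F ∙ v) = ⊥ :=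
        disjoint_iff.1 ((Submodule.disjoint_span_singleton' hv0).2 hvP)
      rw [h2, finrank_bot, finrank_span_singleton hv0, hP] at h1
      omega
    · rw [Submodule.disjoint_def]
      intro x hx hxN
      obtain ⟨p, hp, w, hw, rfl⟩ := Submodule.mem_sup.1 hx
      obtain ⟨c, rfl⟩ := Submodule.mem_span_singleton.1 hw
      have hc : c = 0 := by
        by_contra hc
        refine hv e ?_
        have : v = c⁻¹ • (-p + (p + c • v)) := by
          rw [neg_add_cancel_left, smul_smul, inv_mul_cancel₀ hc, one_smul]
        rw [this]
        exact Submodule.smul_mem _ _ (Submodule.add_mem _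
          (Submodule.mem_sup_left (P.neg_mem hp)) (Submodule.mem_sup_right hxN))
      subst hc
      rw [zero_smul, add_zero] at hxN ⊢
      exact Submodule.disjoint_def.1 (hPN e) p hp hxN

theorem exists_linearMap_ker_eq (U : Submodule F M) :
    ∃ (d : ℕ) (L : M →ₗ[F] (Fin d → F)), LinearMap.ker L = U :=
  ⟨_, (Module.finBasis F (M ⧸ U)).equivFun.toLinearMap ∘ₗ U.mkQ, by
    rw [LinearEquiv.ker_comp, Submodule.ker_mkQ]⟩

theorem exists_linearMap_disjoint_ker {P : Submodule F M} {m : ℕ}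
    (hm : Module.finrank F P = m) :
    ∃ κ : M →ₗ[F] (Fin m → F), Disjoint P (LinearMap.ker κ) := by
  obtain ⟨g, hg⟩ := LinearMap.exists_leftInverse_of_injective P.subtype P.ker_subtype
  refine ⟨(Module.finBasisOfFinrankEq F P hm).equivFun.toLinearMap ∘ₗ g, ?_⟩
  rw [LinearEquiv.ker_comp, Submodule.disjoint_def]
  intro x hx hgx
  have := LinearMap.congr_fun hg ⟨x, hx⟩
  rw [LinearMap.mem_ker] at hgx
  simp only [LinearMap.comp_apply, Submodule.subtype_apply, hgx] at this
  exact (congrArg Subtype.val this).symm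

end Linear

/-! ### The tree-PIN source -/

section Tree

variable {V : Type} (T : SimpleGraph V) [Fintype T.edgeSet] {F : Type} [Field F]
  (len : T.edgeSet → ℕ)

/-- The vectors `x = (x_{e,k})` of one realization of the source. -/
abbrev BaseVector {V : Type} (T : SimpleGraph V) (len : T.edgeSet → ℕ) (F : Type) : Type :=
  (Σ e : T.edgeSet, Fin (len e)) → F

variable (F) in
/-- The linear map `x ↦ Y_e`. -/
def edgeMap (e : T.edgeSet) : BaseVector T len F →ₗ[F] (Fin (len e) → F) :=
  LinearMap.funLeft F F fun k => ⟨e, k⟩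

variable (F) in
/-- The linear map `x ↦ Z_i`. -/
def vertexMap (i : V) : BaseVector T len F →ₗ[F] VertexObs T len F i :=
  LinearMap.pi fun e => edgeMap T F len e.1

variable {T len} {nw : ℕ} (W : Matrix (Σ e : T.edgeSet, Fin (len e)) (Fin nw) F)

/-- The kernel of the common linear function of `Y_e` and `Z_w`, the sum of the
kernels of `x ↦ Y_e` and `x ↦ Z_w`. -/
def commonKernel (e : T.edgeSet) : Submodule F (BaseVector T len F) :=
  LinearMap.ker (edgeMap T F len e) ⊔ LinearMap.ker W.vecMulLinear

/-- The number of symbols of `Y_e` that remain when the common function of `Y_e` and `Z_w` is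
given, which is the dimension of the projection of the kernel of `x ↦ Z_w` to the edge `e`. -/
def edgeSecrecy (e : T.edgeSet) : ℕ :=
  Module.finrank F (commonKernel W e) - Module.finrank F (LinearMap.ker (edgeMap T F len e))

theorem edgeSecrecy_add (e : T.edgeSet) :
    edgeSecrecy W e + Module.finrank F (LinearMap.ker (edgeMap T F len e)) =
      Module.finrank F (commonKernel W e) :=
  Nat.sub_add_cancel (Submodule.finrank_mono le_sup_left)

theorem finrank_inf_add_edgeSecrecy (e : T.edgeSet) :
    Module.finrank F (LinearMap.ker W.vecMulLinear ⊓ LinearMap.ker (edgeMap T F len e) :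
      Submodule F (BaseVector T len F)) + edgeSecrecy W e =
      Module.finrank F (LinearMap.ker W.vecMulLinear) := by
  have h1 : Module.finrank F (commonKernel W e) +
      Module.finrank F (LinearMap.ker W.vecMulLinear ⊓ LinearMap.ker (edgeMap T F len e) :
        Submodule F (BaseVector T len F)) =
      Module.finrank F (LinearMap.ker (edgeMap T F len e)) +
        Module.finrank F (LinearMap.ker W.vecMulLinear) := by
    rw [commonKernel, inf_comm]
    exact Submodule.finrank_sup_add_finrank_inf_eq _ _
  have h2 := edgeSecrecy_add W e
  omega

theorem finrank_wtKernel (hW : W.rank = nw) :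
    Module.finrank F (LinearMap.ker W.vecMulLinear) + nw = ∑ e, len e := by
  have h := LinearMap.finrank_range_add_finrank_ker W.vecMulLinear
  have h2 : Module.finrank F (LinearMap.range W.vecMulLinear) = nw := by
    have h3 : W.vecMulLinear = W.transpose.mulVecLin :=
      LinearMap.ext fun x => (Matrix.mulVec_transpose W x).symm
    rw [h3, ← Matrix.rank, Matrix.rank_transpose, hW]
  rw [h2, Module.finrank_fintype_fun_eq_card] at h
  simp only [Fintype.card_sigma, Fintype.card_fin] at h
  omega

theorem finrank_baseVector : Module.finrank F (BaseVector T len F) = ∑ e, len e := by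
  rw [Module.finrank_fintype_fun_eq_card]
  simp

theorem commonKernel_mkQ_eq_iff (e : T.edgeSet) (x y : BaseVector T len F) :
    (commonKernel W e).mkQ x = (commonKernel W e).mkQ y ↔ x - y ∈ commonKernel W e := by
  rw [← sub_eq_zero, ← map_sub, ← LinearMap.mem_ker, Submodule.ker_mkQ]

variable [Fintype V] [Finite F]

theorem baseLaw_real_singleton (x : (treeSource T len W).Base) :
    (treeSource T len W).baseLaw.real {x} = (Nat.card (BaseVector T len F) : ℝ)⁻¹ := by
  classical
  let _ : Fintype (BaseVector T len F) := Fintype.ofFinite _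
  rw [measureReal_def, WiretapSource.baseLaw,
    PMF.toMeasure_apply_singleton _ _ (measurableSet_singleton x)]
  change ENNReal.toReal (PMF.uniformOfFintype (BaseVector T len F) x) = _
  refine (congrArg ENNReal.toReal (PMF.uniformOfFintype_apply (α := BaseVector T len F) x)).trans ?_
  rw [ENNReal.toReal_inv, Nat.card_eq_fintype_card]
  rfl

/-- The entropy of a function of one realization of the source whose fibres are the cosets of a
subspace. -/
theorem entropy_baseLaw {β : Type*} [Finite β] (U : Submodule F (BaseVector T len F))
    (g : BaseVector T len F → β) (hg : ∀ x y, g x = g y ↔ x - y ∈ U) :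
    entropy (treeSource T len W).baseLaw g =
      ((∑ e, len e : ℕ) - Module.finrank F U : ℝ) * Real.logb 2 (Nat.card F) := by
  rw [← finrank_baseVector (F := F)]
  refine entropy_of_uniform (M := BaseVector T len F) (X := fun x => x)
    (μ := (treeSource T len W).baseLaw) (fun _ => .of_discrete) (fun x y => ?_) U g hg
  exact (baseLaw_real_singleton W x).trans (baseLaw_real_singleton W y).symm

/-- The entropy of a function of `n` realizations of the source whose fibres are the cosets of a
subspace. -/
theorem entropy_law {n : ℕ} (D : Discussion (treeSource T len W) n) {β : Type*} [Finite β]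
    (U : Submodule F (Fin n → BaseVector T len F))
    (g : (Fin n → BaseVector T len F) → β) (hg : ∀ x y, g x = g y ↔ x - y ∈ U) :
    entropy D.law (fun ω => g ω.1) =
      (n * (∑ e, len e : ℕ) - Module.finrank F U : ℝ) * Real.logb 2 (Nat.card F) := by
  have hd : Module.finrank F (Fin n → BaseVector T len F) = n * ∑ e, len e := by
    rw [Module.finrank_pi_fintype, Finset.sum_const, finrank_baseVector]
    simp
  have := entropy_of_uniform (M := Fin n → BaseVector T len F) (X := fun ω : D.Sample => ω.1)
    (μ := D.law) (D.fiberMeasurable_base fun x => x) (fun x y => ?_) U g hg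
  · rw [this, hd]
    push_cast
    rfl
  · have h : ∀ x : Fin n → (treeSource T len W).Base,
        D.law.real ((fun ω : D.Sample => ω.1) ⁻¹' {x}) =
          ∏ _t : Fin n, (Nat.card (BaseVector T len F) : ℝ)⁻¹ := by
      intro x
      have := D.law_real_base {x}
      rw [measureReal_def (Measure.pi _), Measure.pi_singleton, ENNReal.toReal_prod] at this
      refine this.trans (Finset.prod_congr rfl fun t _ => ?_)
      exact baseLaw_real_singleton W (x t)
    exact (h x).trans (h y).symm

theorem edgeVector_eq_iff (e : T.edgeSet) (x y : BaseVector T len F) :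
    edgeVector T len W e x = edgeVector T len W e y ↔
      x - y ∈ LinearMap.ker (edgeMap T F len e) := by
  rw [LinearMap.mem_ker, map_sub, sub_eq_zero]
  rfl

theorem wt_eq_iff (x y : BaseVector T len F) :
    (treeSource T len W).wt x = (treeSource T len W).wt y ↔
      x - y ∈ LinearMap.ker W.vecMulLinear := by
  rw [LinearMap.mem_ker, map_sub, sub_eq_zero]
  rfl

/-- The quotient map by `commonKernel W e` is, up to relabelling, a maximal common function of
`Y_e` and `Z_w`. -/
theorem condEntropy_edgeVector {e : T.edgeSet} {γ : Type} [Finite γ]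
    {G : (treeSource T len W).Base → γ}
    (hG : IsMaximalCommonFunction (treeSource T len W).baseLaw
      (edgeVector T len W e) (treeSource T len W).wt G) :
    condEntropy (treeSource T len W).baseLaw (edgeVector T len W e) G =
      edgeSecrecy W e * Real.logb 2 (Nat.card F) := by
  obtain ⟨⟨-, hGY, hGZ⟩, hmax⟩ := hG
  set μ := (treeSource T len W).baseLaw with hμ
  have hY := entropy_baseLaw W _ _ (edgeVector_eq_iff W e)
  have hZ := entropy_baseLaw W _ _ (wt_eq_iff W)
  have hQ := entropy_baseLaw W _ _ (commonKernel_mkQ_eq_iff W e)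
  have hpos : ∀ x : (treeSource T len W).Base, 0 < μ.real {x} := by
    intro x
    rw [baseLaw_real_singleton]
    exact inv_pos.2 (by exact_mod_cast Nat.card_pos)
  have hGQ : ∀ x y : BaseVector T len F, x - y ∈ commonKernel W e → G x = G y := by
    intro x y hxy
    obtain ⟨u, hu, v, hv, huv⟩ := Submodule.mem_sup.1 hxy
    have h1 : G x = G (x - u : BaseVector T len F) :=
      eq_of_condEntropy_eq_zero G (edgeVector T len W e) hGY hpos
        ((edgeVector_eq_iff W e _ _).2 (by simpa using hu))
    have h2 : G (x - u : BaseVector T len F) = G y :=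
      eq_of_condEntropy_eq_zero G (treeSource T len W).wt hGZ hpos
        ((wt_eq_iff W _ _).2 (by
          have : x - u - y = v := by
            rw [sub_right_comm, ← huv]
            simp
          rw [this]
          exact hv))
    exact h1.trans h2
  have hle : entropy μ G ≤ entropy μ (commonKernel W e).mkQ := by
    have h1 : G = fun x => Function.extend (commonKernel W e).mkQ G
        (fun _ => G (0 : BaseVector T len F)) ((commonKernel W e).mkQ x) := by
      funext x
      refine (Function.FactorsThrough.extend_apply (g := (G : BaseVector T len F → γ)) ?_ _ x).symm
      intro x y hxy
      exact hGQ x y ((commonKernel_mkQ_eq_iff W e x y).1 hxy)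
    rw [h1]
    exact entropy_comp_le (Ω := (treeSource T len W).Base) (X := (commonKernel W e).mkQ) (fun _ => .of_discrete) _
  have hge : entropy μ (commonKernel W e).mkQ ≤ entropy μ G := by
    let φ := Finite.equivFin (BaseVector T len F ⧸ commonKernel W e)
    have hφ : entropy μ (fun x => φ ((commonKernel W e).mkQ x)) =
      entropy μ (commonKernel W e).mkQ := entropy_relabel _ _ _ φ.injective.injOn
    rw [← hφ]
    refine hmax _ _ ⟨fun _ => .of_discrete, ?_, ?_⟩
    · rw [condEntropy, hY, sub_eq_zero]
      refine entropy_baseLaw W _ (fun x => (φ ((commonKernel W e).mkQ x), edgeVector T len W e x))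
        fun x y => ?_
      rw [Prod.mk.injEq, edgeVector_eq_iff, φ.apply_eq_iff_eq, commonKernel_mkQ_eq_iff]
      exact and_iff_right_of_imp fun h => Submodule.mem_sup_left h
    · rw [condEntropy, hZ, sub_eq_zero]
      refine entropy_baseLaw W _ (fun x => (φ ((commonKernel W e).mkQ x),
        (treeSource T len W).wt x)) fun x y => ?_
      rw [Prod.mk.injEq, wt_eq_iff, φ.apply_eq_iff_eq, commonKernel_mkQ_eq_iff]
      exact and_iff_right_of_imp fun h => Submodule.mem_sup_right h
  have hYG : entropy μ (fun x => (edgeVector T len W e x, G x)) =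
      entropy μ (edgeVector T len W e) := by
    refine (entropy_baseLaw W _ (fun x => (edgeVector T len W e x, G x)) fun x y => ?_).trans hY.symm
    rw [Prod.mk.injEq, edgeVector_eq_iff]
    exact and_iff_left_of_imp fun h => hGQ x y (Submodule.mem_sup_left h)
  have hr := edgeSecrecy_add W e
  rw [condEntropy, hYG, hle.antisymm hge, hY, hQ, ← hr]
  push_cast
  ring

theorem exists_isCut (hT : T.IsTree) (e : T.edgeSet) :
    ∃ (A : Set V) (σ : (treeSource T len W).Base → (treeSource T len W).Base →
      (treeSource T len W).Base) (a b : V),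
      (treeSource T len W).IsCut A (edgeVector T len W e) σ ∧ a ∈ A ∧ b ∉ A := by
  classical
  obtain ⟨e, he⟩ := e
  induction e using Sym2.ind with
  | _ a b =>
  set H := T \ SimpleGraph.fromEdgeSet {s(a, b)} with hH
  have hab : ¬ H.Reachable a b :=
    (SimpleGraph.isBridge_iff.1
      (SimpleGraph.isAcyclic_iff_forall_isBridge.1 hT.isAcyclic he))
  refine ⟨{i | H.Reachable a i}, fun x x' (p : Σ e : T.edgeSet, Fin (len e)) =>
    if ∃ i ∈ (p.1 : Sym2 V), H.Reachable a i then x p else x' p, a, b, ?_, .refl a, hab⟩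
  refine ⟨fun x x' => (baseLaw_real_singleton W x).trans (baseLaw_real_singleton W x').symm,
    fun x x' => ?_, fun x x' => ?_, fun x x' i hi => ?_, fun x x' hxx i hi => ?_⟩
  · funext p
    by_cases h : ∃ i ∈ (p.1 : Sym2 V), H.Reachable a i
    · simp only [if_pos h]
    · simp only [if_neg h]
  · funext k
    exact if_pos ⟨a, by simp, .refl a⟩
  · funext f k
    exact if_pos ⟨i, f.2, hi⟩
  · funext f k
    obtain ⟨⟨f, hf⟩, hif⟩ := f
    by_cases hfe : f = s(a, b)
    · subst hfe
      have := congrFun hxx k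
      change (if _ then x ⟨⟨s(a, b), he⟩, k⟩ else x' ⟨⟨s(a, b), he⟩, k⟩) = x' ⟨⟨s(a, b), he⟩, k⟩
      change x ⟨⟨s(a, b), he⟩, k⟩ = x' ⟨⟨s(a, b), he⟩, k⟩ at this
      rw [this, ite_self]
    · refine if_neg ?_
      rintro ⟨j, hj, haj⟩
      refine hi ?_
      have hij : i ≠ j := fun h => hi (h ▸ haj)
      have hfij : f = s(i, j) := (Sym2.mem_and_mem_iff hij).1 ⟨hif, hj⟩
      refine SimpleGraph.Reachable.trans haj (SimpleGraph.Adj.reachable ?_)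
      rw [hH, SimpleGraph.sdiff_adj, SimpleGraph.fromEdgeSet_adj]
      refine ⟨?_, fun h => hfe ?_⟩
      · rw [← SimpleGraph.mem_edgeSet, Sym2.eq_swap, ← hfij]
        exact hf
      · rw [hfij, Sym2.eq_swap]
        exact h.1

/-- The converse bound for the tree-PIN source. -/
theorem condEntropy_le_edgeSecrecy (hT : T.IsTree) (e : T.edgeSet) {n : ℕ}
    {D : Discussion (treeSource T len W) n} {α : Type} [Finite α] (E : D.Outputs α)
    {K : D.Sample → α} (hK : FiberMeasurable K) :
    condEntropy D.law K (fun ω => (D.transcript ω, D.wtBlock ω)) ≤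
      n * (edgeSecrecy W e * Real.logb 2 (Nat.card F)) + 2 +
        2 * (1 - D.law.real {ω | ∀ i, E.eval i ω = K ω}) * Real.logb 2 (Nat.card α) := by
  obtain ⟨A, σ, a, b, hσ, ha, hb⟩ := exists_isCut W hT e
  have : Finite (treeSource T len W).Wt := (treeSource T len W).wtFinite
  -- The common function, as a function of the observation of the wiretapper.
  let J : (treeSource T len W).Wt → BaseVector T len F ⧸ commonKernel W e :=
    Function.extend (treeSource T len W).wt (commonKernel W e).mkQ fun _ => 0
  have hJ : ∀ x : BaseVector T len F,
      J ((treeSource T len W).wt x) = (commonKernel W e).mkQ x := by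
    refine Function.FactorsThrough.extend_apply
      (g := ((commonKernel W e).mkQ : BaseVector T len F → _)) ?_ _
    intro x y hxy
    exact (commonKernel_mkQ_eq_iff W e x y).2
      (Submodule.mem_sup_right ((wt_eq_iff W x y).1 hxy))
  refine (E.condEntropy_le hσ ha hb J hK).trans (le_of_eq ?_)
  congr 2
  have hYker : ∀ x y : Fin n → BaseVector T len F,
      (fun t => edgeVector T len W e (x t)) = (fun t => edgeVector T len W e (y t)) ↔
        x - y ∈ LinearMap.ker ((edgeMap T F len e).compLeft (Fin n)) := by
    intro x y
    rw [LinearMap.mem_ker, map_sub, sub_eq_zero]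
    rfl
  have hJker : ∀ x y : Fin n → BaseVector T len F,
      (fun t => J ((treeSource T len W).wt (x t))) = (fun t => J ((treeSource T len W).wt (y t))) ↔
        x - y ∈ LinearMap.ker ((commonKernel W e).mkQ.compLeft (Fin n)) := by
    intro x y
    rw [LinearMap.mem_ker, map_sub, sub_eq_zero]
    simp only [hJ]
    rfl
  have h1 := entropy_law W D _ (fun x t => J ((treeSource T len W).wt (x t))) hJker
  have h2 := entropy_law W D (LinearMap.ker ((edgeMap T F len e).compLeft (Fin n)))
    (fun x => ((fun t => edgeVector T len W e (x t)), fun t => J ((treeSource T len W).wt (x t))))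
    (fun x y => by
      rw [Prod.mk.injEq, hYker, hJker]
      refine and_iff_left_of_imp fun h => ?_
      rw [LinearMap.mem_ker] at h ⊢
      funext t
      have := congrFun h t
      simp only [LinearMap.compLeft_apply] at this ⊢
      rw [Function.comp_apply] at this ⊢
      rw [Pi.zero_apply, ← LinearMap.mem_ker, Submodule.ker_mkQ]
      exact Submodule.mem_sup_left this)
  rw [finrank_ker_compLeft] at h1 h2
  rw [Submodule.ker_mkQ, ← edgeSecrecy_add] at h1
  rw [condEntropy]
  refine (congrArg₂ (· - ·) h2 h1).trans ?_
  push_cast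
  ring

end Tree

/-! ### Linear discussions that are aligned with the wiretapper -/

section Achievability

variable {V : Type} {T : SimpleGraph V} {F : Type} [Field F]
  {len : T.edgeSet → ℕ}

theorem allObs_injective {n : ℕ} {x y : Fin n → BaseVector T len F}
    (h : ∀ i, (vertexMap T F len i).compLeft (Fin n) x =
      (vertexMap T F len i).compLeft (Fin n) y) : x = y := by
  funext t ⟨e, k⟩
  obtain ⟨⟨a, b⟩, he⟩ := e
  exact congrFun (congrFun (congrFun (h a) t) ⟨⟨s(a, b), he⟩, by simp⟩) k

/-- Over a connected graph, a block that looks to every user like an element of `P` is an element of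
`P`, if every edge determines the elements of `P`: neighbours see the same element. -/
theorem mem_of_forall_vertexMap_mem (hT : T.Connected) {n : ℕ}
    {P : Submodule F (Fin n → BaseVector T len F)}
    (hP : ∀ e, Disjoint P (LinearMap.ker ((edgeMap T F len e).compLeft (Fin n))))
    {x : Fin n → BaseVector T len F}
    (hx : ∀ i, (vertexMap T F len i).compLeft (Fin n) x ∈
      P.map ((vertexMap T F len i).compLeft (Fin n))) : x ∈ P := by
  choose p hp hpx using hx
  have hedge : ∀ i (e : T.edgeSet), i ∈ (e : Sym2 V) → ∀ t k, p i t ⟨e, k⟩ = x t ⟨e, k⟩ := by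
    intro i e hi t k
    exact congrFun (congrFun (congrFun (hpx i) t) ⟨e, hi⟩) k
  have hadj : ∀ i j, T.Adj i j → p i = p j := by
    intro i j hij
    rw [← sub_eq_zero]
    refine Submodule.disjoint_def.1 (hP ⟨s(i, j), hij⟩) _ (P.sub_mem (hp i) (hp j)) ?_
    rw [LinearMap.mem_ker, map_sub, sub_eq_zero]
    funext t k
    exact (hedge i ⟨s(i, j), hij⟩ (by simp) t k).trans
      (hedge j ⟨s(i, j), hij⟩ (by simp) t k).symm
  have hall : ∀ i j, p i = p j := by
    intro i j
    obtain ⟨w⟩ := hT.preconnected i j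
    induction w with
    | nil => rfl
    | cons h _ ih => exact (hadj _ _ h).trans ih
  obtain ⟨i₀⟩ := hT.nonempty
  have : x = p i₀ := by
    funext t ⟨e, k⟩
    obtain ⟨⟨a, b⟩, he⟩ := e
    rw [hall i₀ a]
    exact (hedge a ⟨s(a, b), he⟩ (by simp) t k).symm
  rw [this]
  exact hp i₀

/-- On a connected graph with at least two vertices every user sees some edge, and one
edge determines the elements of `P`. -/
theorem eq_zero_of_vertexMap_eq_zero [Nontrivial V] (hT : T.Connected) {n : ℕ}
    {P : Submodule F (Fin n → BaseVector T len F)}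
    (hP : ∀ e, Disjoint P (LinearMap.ker ((edgeMap T F len e).compLeft (Fin n))))
    {x : Fin n → BaseVector T len F} (hx : x ∈ P) (i : V)
    (hi : (vertexMap T F len i).compLeft (Fin n) x = 0) : x = 0 := by
  obtain ⟨j, hij⟩ := hT.preconnected.exists_adj_of_nontrivial i
  refine Submodule.disjoint_def.1 (hP ⟨s(i, j), hij⟩) x hx ?_
  rw [LinearMap.mem_ker]
  funext t
  exact congrFun (congrFun hi t) ⟨⟨s(i, j), hij⟩, by simp⟩

variable [Fintype T.edgeSet] [Finite F] {nw : ℕ}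
  (W : Matrix (Σ e : T.edgeSet, Fin (len e)) (Fin nw) F)

/-- There is a subspace of source blocks that are invisible to the wiretapper, of dimension
`n s - O(1)`, whose elements are determined by their restriction to any single edge. It holds the
secrecy that the linear discussion leaves. -/
theorem exists_invisible_submodule [Nonempty T.edgeSet] {s : ℕ}
    (hs : ∀ e, s ≤ edgeSecrecy W e) (n : ℕ) :
    ∃ P : Submodule F (Fin n → BaseVector T len F),
      Module.finrank F P = n * s - Fintype.card T.edgeSet ∧
      P ≤ LinearMap.ker (W.vecMulLinear.compLeft (Fin n)) ∧
      ∀ e, Disjoint P (LinearMap.ker ((edgeMap T F len e).compLeft (Fin n))) := by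
  set R := LinearMap.ker W.vecMulLinear with hR
  obtain ⟨P, hP, hd⟩ := exists_submodule_disjoint (M := Fin n → R)
    (fun e => LinearMap.ker ((edgeMap T F len e ∘ₗ R.subtype).compLeft (Fin n))) (n * s) (by
      intro e
      have h1 : Module.finrank F (LinearMap.ker (edgeMap T F len e ∘ₗ R.subtype)) =
          Module.finrank F (R ⊓ LinearMap.ker (edgeMap T F len e) : Submodule F _) := by
        rw [LinearMap.ker_comp, ← Submodule.map_comap_subtype, Submodule.finrank_map_subtype_eq]
      rw [finrank_ker_compLeft, h1, Module.finrank_pi_fintype, Finset.sum_const, Finset.card_univ,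
        Fintype.card_fin, smul_eq_mul, ← mul_add]
      refine Nat.mul_le_mul_left n ?_
      exact (Nat.add_le_add_left (hs e) _).trans (finrank_inf_add_edgeSecrecy W e).le)
  have hinj : Function.Injective (R.subtype.compLeft (Fin n)) := fun x y hxy =>
    funext fun t => Subtype.ext (congrFun hxy t)
  refine ⟨P.map (R.subtype.compLeft (Fin n)), ?_, ?_, fun e => ?_⟩
  · rw [← (Submodule.equivMapOfInjective _ hinj P).finrank_eq, hP]
  · rintro _ ⟨x, -, rfl⟩
    rw [LinearMap.mem_ker]
    exact funext fun t => (x t).2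
  · rw [Submodule.disjoint_def]
    rintro _ ⟨x, hx, rfl⟩ hxe
    rw [Submodule.disjoint_def.1 (hd e) x hx hxe, map_zero]

variable [Fintype V]

/-- Users that determine the source block from their own observations and the communication can
output any function of it. -/
theorem exists_outputs {n : ℕ} (D : Discussion (treeSource T len W) n)
    (tr : (Fin n → BaseVector T len F) → D.Transcript) (htr : ∀ ω, D.transcript ω = tr ω.1)
    (hdec : ∀ i (x y : Fin n → BaseVector T len F), (vertexMap T F len i).compLeft (Fin n) x =
      (vertexMap T F len i).compLeft (Fin n) y → tr x = tr y → x = y)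
    {α : Type} (g : (Fin n → BaseVector T len F) → α) :
    ∃ E : D.Outputs α, ∀ i ω, E.eval i ω = g ω.1 := by
  classical
  refine ⟨⟨fun i z _ f => if h : ∃ x : Fin n → BaseVector T len F,
      (vertexMap T F len i).compLeft (Fin n) x = z ∧ tr x = f then g h.choose else g 0,
    fun _ _ _ _ => .const _⟩, fun i ω => ?_⟩
  have h : ∃ x : Fin n → BaseVector T len F,
      (vertexMap T F len i).compLeft (Fin n) x = D.obsBlock i ω ∧ tr x = D.transcript ω :=
    ⟨ω.1, rfl, (htr ω).symm⟩
  refine (dif_pos h).trans (congrArg g ?_)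
  exact hdec i _ _ h.choose_spec.1 (h.choose_spec.2.trans (htr ω))

theorem condMutualInfo_eq (hW : W.rank = nw) {n : ℕ} (D : Discussion (treeSource T len W) n) :
    condMutualInfo D.law D.transcript D.allObsBlock D.wtBlock =
      n * ((((∑ e, len e : ℕ) : ℝ) - nw) * Real.logb 2 (Nat.card F)) -
        condEntropy D.law D.allObsBlock (fun ω => (D.transcript ω, D.wtBlock ω)) := by
  have hwt : ∀ x y : Fin n → BaseVector T len F,
      (fun t => (treeSource T len W).wt (x t)) = (fun t => (treeSource T len W).wt (y t)) ↔
        x - y ∈ LinearMap.ker (W.vecMulLinear.compLeft (Fin n)) := by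
    intro x y
    rw [LinearMap.mem_ker, map_sub, sub_eq_zero]
    rfl
  have h1 : entropy D.law D.wtBlock = _ :=
    entropy_law W D _ (fun x t => (treeSource T len W).wt (x t)) hwt
  have h2 : entropy D.law (fun ω => (D.allObsBlock ω, D.wtBlock ω)) = _ :=
    entropy_law W D ⊥ (fun x => ((fun i t => (treeSource T len W).obs i (x t)),
      fun t => (treeSource T len W).wt (x t))) (fun x y => by
        rw [Submodule.mem_bot, sub_eq_zero]
        refine ⟨fun h => allObs_injective fun i => ?_, fun h => by rw [h]⟩
        exact congrFun (congrArg Prod.fst h) i)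
  have h3 := entropy_relabel D.law (fun ω => (D.transcript ω, D.allObsBlock ω, D.wtBlock ω))
    (fun p => (p.2.1, p.1, p.2.2))
    (by rintro ⟨p1, p2, p3⟩ _ ⟨q1, q2, q3⟩ _ h; simp at h; simp [h])
  have h4 := finrank_wtKernel W hW
  rw [finrank_ker_compLeft] at h1
  rw [finrank_bot] at h2
  simp only [condMutualInfo, condEntropy]
  rw [h1, h2, h3, ← h4]
  push_cast
  ring

/-- One linear non-interactive discussion serves both purposes. User `i` sends its observation
modulo the image of the subspace of `exists_invisible_submodule`, so the communication reveals
exactly the block modulo this subspace. As the subspace is invisible to the wiretapper, its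
observation is a function of the communication. -/
theorem exists_linearDiscussion [Nontrivial V] (hT : T.Connected) (hW : W.rank = nw)
    [Nonempty T.edgeSet] {s : ℕ} (hs : ∀ e, s ≤ edgeSecrecy W e) (n : ℕ) :
    ∃ (D : Discussion (treeSource T len W) n)
      (E : D.Outputs (∀ i, Fin n → (treeSource T len W).Obs i))
      (key : D.Sample → Fin (Nat.card F ^ (n * s - Fintype.card T.edgeSet)))
      (E' : D.Outputs (Fin (Nat.card F ^ (n * s - Fintype.card T.edgeSet)))),
      IsLinearNonInteractive D ∧ (∀ i ω, E.eval i ω = D.allObsBlock ω) ∧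
      FiberMeasurable key ∧ (∀ i ω, E'.eval i ω = key ω) ∧
      condEntropy D.law key (fun ω => (D.transcript ω, D.wtBlock ω)) =
        (n * s - Fintype.card T.edgeSet : ℕ) * Real.logb 2 (Nat.card F) ∧
      condMutualInfo D.law D.transcript D.allObsBlock D.wtBlock =
        n * ((((∑ e, len e : ℕ) : ℝ) - nw) * Real.logb 2 (Nat.card F)) -
          (n * s - Fintype.card T.edgeSet : ℕ) * Real.logb 2 (Nat.card F) := by
  obtain ⟨P, hPm, hPW, hPe⟩ := exists_invisible_submodule W hs n
  choose d L hL using fun i =>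
    exists_linearMap_ker_eq (F := F) (P.map ((vertexMap T F len i).compLeft (Fin n)))
  set m := n * s - Fintype.card T.edgeSet
  obtain ⟨κ, hκ⟩ := exists_linearMap_disjoint_ker hPm
  let D := linearDiscussion T len W n d L
  let tr : (Fin n → BaseVector T len F) → D.Transcript := fun x =>
    ((), fun i => L i ((vertexMap T F len i).compLeft (Fin n) x))
  have htr : ∀ ω, D.transcript ω = tr ω.1 := fun ω => rfl
  have htr_iff : ∀ x y, tr x = tr y ↔ x - y ∈ P := by
    intro x y
    have h1 : tr x = tr y ↔ ∀ i, (vertexMap T F len i).compLeft (Fin n) (x - y) ∈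
        P.map ((vertexMap T F len i).compLeft (Fin n)) := by
      simp only [← hL, LinearMap.mem_ker, map_sub, sub_eq_zero]
      exact ⟨fun h i => congrFun (congrArg Prod.snd h) i,
        fun h => congrArg (Prod.mk ()) (funext h)⟩
    rw [h1]
    exact ⟨mem_of_forall_vertexMap_mem hT hPe, fun h i => Submodule.mem_map_of_mem h⟩
  have hdec : ∀ i (x y : Fin n → BaseVector T len F), (vertexMap T F len i).compLeft (Fin n) x =
      (vertexMap T F len i).compLeft (Fin n) y → tr x = tr y → x = y := by
    intro i x y hxy h
    rw [← sub_eq_zero]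
    refine eq_zero_of_vertexMap_eq_zero hT hPe ((htr_iff x y).1 h) i ?_
    rw [map_sub, hxy, sub_self]
  have hcard : Nat.card (Fin m → F) = Nat.card F ^ m := by
    rw [Nat.card_fun, Nat.card_fin]
  let φ : (Fin m → F) ≃ Fin (Nat.card F ^ m) := Finite.equivFinOfCardEq hcard
  obtain ⟨E, hE⟩ := exists_outputs W D tr htr hdec fun x i t => (treeSource T len W).obs i (x t)
  obtain ⟨E', hE'⟩ := exists_outputs W D tr htr hdec fun x => φ (κ x)
  have hwt : ∀ x y : Fin n → BaseVector T len F,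
      tr x = tr y → (fun t => (treeSource T len W).wt (x t)) =
        (fun t => (treeSource T len W).wt (y t)) := by
    intro x y h
    have h1 := hPW ((htr_iff x y).1 h)
    rw [LinearMap.mem_ker, map_sub, sub_eq_zero] at h1
    exact h1
  have hFW : entropy D.law (fun ω => (D.transcript ω, D.wtBlock ω)) = _ :=
    entropy_law W D P (fun x => (tr x, fun t => (treeSource T len W).wt (x t))) (fun x y => by
      rw [Prod.mk.injEq, ← htr_iff]
      exact and_iff_left_of_imp (hwt x y))
  refine ⟨D, E, fun ω => φ (κ ω.1), E', ⟨d, L, rfl⟩, fun i ω => hE i ω,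
    D.fiberMeasurable_base (fun x => φ (κ x)), hE', ?_, ?_⟩
  · have hKFW : entropy D.law (fun ω => (φ (κ ω.1), D.transcript ω, D.wtBlock ω)) = _ :=
      entropy_law W D ⊥ (fun x => (φ (κ x), tr x, fun t => (treeSource T len W).wt (x t)))
      (fun x y => by
        rw [Prod.mk.injEq, Prod.mk.injEq, φ.apply_eq_iff_eq, Submodule.mem_bot, sub_eq_zero]
        refine ⟨fun h => ?_, fun h => by simp [h]⟩
        rw [← sub_eq_zero]
        refine Submodule.disjoint_def.1 hκ _ ((htr_iff x y).1 h.2.1) ?_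
        rw [LinearMap.mem_ker, map_sub, h.1, sub_self])
    rw [condEntropy, hKFW, hFW, hPm, finrank_bot]
    push_cast
    ring
  · have hZFW : entropy D.law (fun ω => (D.allObsBlock ω, D.transcript ω, D.wtBlock ω)) = _ :=
      entropy_law W D ⊥ (fun x => ((fun i t => (treeSource T len W).obs i (x t)), tr x,
        fun t => (treeSource T len W).wt (x t)))
      (fun x y => by
        rw [Submodule.mem_bot, sub_eq_zero]
        refine ⟨fun h => allObs_injective fun i => ?_, fun h => by rw [h]⟩
        exact congrFun (congrArg Prod.fst h) i)
    rw [condMutualInfo_eq W hW, condEntropy, hZFW, hFW, hPm, finrank_bot]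
    push_cast
    ring

end Achievability

/-! ### Rates -/

section Rates

variable {V : Type} [Fintype V] {T : SimpleGraph V} [Fintype T.edgeSet] {F : Type} [Field F]
  [Finite F] {len : T.edgeSet → ℕ} {nw : ℕ}
  (W : Matrix (Σ e : T.edgeSet, Fin (len e)) (Fin nw) F)

/-- No key rate exceeds the secrecy of an edge. Fano's term contains the size of the key, which may
grow arbitrarily fast with `n`, so the bound is solved for it. -/
theorem KeyScheme.rate_le (hT : T.IsTree) (S : KeyScheme (treeSource T len W)) (e : T.edgeSet) :
    S.rate ≤ ((edgeSecrecy W e * Real.logb 2 (Nat.card F) : ℝ) : EReal) := by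
  set c : ℝ := edgeSecrecy W e * Real.logb 2 (Nat.card F) with hc
  let l : ℕ → ℝ := fun n => Real.logb 2 (S.keySize n)
  let δ : ℕ → ℝ := fun n => Real.logb 2 (S.keySize n) - condEntropy (S.disc n).law (S.key n)
    (fun ω => ((S.disc n).transcript ω, (S.disc n).wtBlock ω))
  let ε : ℕ → ℝ := fun n => 1 - (S.disc n).law.real {ω | ∀ i, (S.outputs n).eval i ω = S.key n ω}
  have hδ : Tendsto δ atTop (𝓝 0) := S.secrecy
  have hε : Tendsto ε atTop (𝓝 0) := by
    simpa [ε] using (tendsto_const_nhds (x := (1 : ℝ))).sub S.recoverability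
  have hden : Tendsto (fun n => 1 - 2 * ε n) atTop (𝓝 1) := by
    simpa using (tendsto_const_nhds (x := (1 : ℝ))).sub (hε.const_mul 2)
  have hinv : Tendsto (fun n : ℕ => 1 / (n : ℝ)) atTop (𝓝 0) := tendsto_one_div_atTop_nhds_zero_nat
  have hlim : Tendsto (fun n => (c + (δ n + 2) * (1 / (n : ℝ))) / (1 - 2 * ε n)) atTop (𝓝 c) := by
    have h := (((hδ.add_const 2).mul hinv).const_add c).div hden one_ne_zero
    rw [mul_zero, add_zero, div_one] at h
    exact h
  have hle : ∀ᶠ n : ℕ in atTop,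
      1 / (n : ℝ) * l n ≤ (c + (δ n + 2) * (1 / (n : ℝ))) / (1 - 2 * ε n) := by
    filter_upwards [hden.eventually (lt_mem_nhds zero_lt_one), eventually_gt_atTop 0] with n hn hn0
    have h := condEntropy_le_edgeSecrecy W hT e (S.outputs n) (S.key_measurable n)
    rw [Nat.card_fin] at h
    have h2 : l n * (1 - 2 * ε n) ≤ n * c + (δ n + 2) := by
      have : l n - δ n ≤ n * c + 2 + 2 * ε n * l n := by
        simpa only [l, δ, ε, sub_sub_cancel] using h
      linarith
    have hn' : (0 : ℝ) < n := by exact_mod_cast hn0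
    rw [le_div_iff₀ hn]
    calc 1 / (n : ℝ) * l n * (1 - 2 * ε n) = 1 / (n : ℝ) * (l n * (1 - 2 * ε n)) := by ring
      _ ≤ 1 / (n : ℝ) * (n * c + (δ n + 2)) := by gcongr
      _ = c + (δ n + 2) * (1 / (n : ℝ)) := by field_simp
  have hlim' := (continuous_coe_real_ereal.tendsto c).comp hlim
  rw [← hlim'.liminf_eq]
  exact liminf_le_liminf (hle.mono fun n h => EReal.coe_le_coe_iff.2 h)

theorem le_leakageRate (hT : T.IsTree) (hW : W.rank = nw)
    (S : OmniscienceScheme (treeSource T len W)) (e : T.edgeSet) :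
    (((((∑ e, len e : ℕ) : ℝ) - nw) * Real.logb 2 (Nat.card F) -
      edgeSecrecy W e * Real.logb 2 (Nat.card F) : ℝ) : EReal) ≤ S.leakageRate := by
  set c : ℝ := edgeSecrecy W e * Real.logb 2 (Nat.card F) with hc
  set H : ℝ := (((∑ e, len e : ℕ) : ℝ) - nw) * Real.logb 2 (Nat.card F) with hH
  set C : ℝ := Real.logb 2 (∏ i, Nat.card ((treeSource T len W).Obs i) : ℕ) with hC
  let ε : ℕ → ℝ := fun n =>
    1 - (S.disc n).law.real {ω | ∀ i, (S.outputs n).eval i ω = (S.disc n).allObsBlock ω}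
  have hε : Tendsto ε atTop (𝓝 0) := by
    simpa [ε] using (tendsto_const_nhds (x := (1 : ℝ))).sub S.recoverability
  have hinv : Tendsto (fun n : ℕ => 1 / (n : ℝ)) atTop (𝓝 0) := tendsto_one_div_atTop_nhds_zero_nat
  have hlim : Tendsto (fun n : ℕ => H - c - 2 * (1 / (n : ℝ)) - 2 * ε n * C) atTop
      (𝓝 (H - c)) := by
    have h := ((hinv.const_mul 2).const_sub (H - c)).sub ((hε.const_mul 2).mul_const C)
    simpa using h
  have hcard : ∀ n : ℕ, Real.logb 2 (Nat.card (∀ i, Fin n → (treeSource T len W).Obs i)) =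
      n * C := by
    intro n
    rw [Nat.card_pi, hC, ← Real.logb_pow]
    congr 1
    rw [← Nat.cast_pow, ← Finset.prod_pow]
    congr 1
    exact Finset.prod_congr rfl fun i _ => by rw [Nat.card_fun, Nat.card_fin]
  have hle : ∀ᶠ n : ℕ in atTop, H - c - 2 * (1 / (n : ℝ)) - 2 * ε n * C ≤
      1 / (n : ℝ) * condMutualInfo (S.disc n).law (S.disc n).transcript
        (S.disc n).allObsBlock (S.disc n).wtBlock := by
    filter_upwards [eventually_gt_atTop 0] with n hn0
    have h := condEntropy_le_edgeSecrecy W hT e (S.outputs n) (K := (S.disc n).allObsBlock)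
      ((S.disc n).fiberMeasurable_base fun x i t => (treeSource T len W).obs i (x t))
    rw [hcard] at h
    rw [condMutualInfo_eq W hW]
    have hn' : (0 : ℝ) < n := by exact_mod_cast hn0
    calc H - c - 2 * (1 / (n : ℝ)) - 2 * ε n * C
        = 1 / (n : ℝ) * (n * H - (n * c + 2 + 2 * ε n * (n * C))) := by
          field_simp
          ring
      _ ≤ _ := by gcongr
  have hlim' := (continuous_coe_real_ereal.tendsto _).comp hlim
  rw [← hlim'.limsup_eq]
  exact limsup_le_limsup (hle.mono fun n h => EReal.coe_le_coe_iff.2 h)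

/-- The truncated subtraction matters only when `s = 0` or `n` is small. -/
theorem tendsto_truncated_rate (s E : ℕ) :
    Tendsto (fun n : ℕ => 1 / (n : ℝ) * (n * s - E : ℕ)) atTop (𝓝 s) := by
  have hinv : Tendsto (fun n : ℕ => 1 / (n : ℝ)) atTop (𝓝 0) := tendsto_one_div_atTop_nhds_zero_nat
  have hlim : Tendsto (fun n : ℕ => (s : ℝ) - 1 / (n : ℝ) * E) atTop (𝓝 s) := by
    simpa using (hinv.mul_const (E : ℝ)).const_sub (s : ℝ)
  refine tendsto_of_tendsto_of_tendsto_of_le_of_le' hlim tendsto_const_nhds ?_ ?_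
  · filter_upwards [eventually_gt_atTop 0] with n hn
    have hn' : (0 : ℝ) < n := by exact_mod_cast hn
    have h : ((n * s : ℕ) : ℝ) ≤ (n * s - E : ℕ) + E := by exact_mod_cast (by omega)
    push_cast at h
    calc (s : ℝ) - 1 / (n : ℝ) * E = 1 / (n : ℝ) * (n * s - E) := by field_simp
      _ ≤ _ := by
        gcongr
        linarith
  · filter_upwards [eventually_gt_atTop 0] with n hn
    have hn' : (0 : ℝ) < n := by exact_mod_cast hn
    have h : ((n * s - E : ℕ) : ℝ) ≤ (n * s : ℕ) := by exact_mod_cast Nat.sub_le _ _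
    push_cast at h
    calc 1 / (n : ℝ) * (n * s - E : ℕ) ≤ 1 / (n : ℝ) * (n * s) := by gcongr
      _ = s := by field_simp

theorem exists_schemes [Nontrivial V] (hT : T.Connected) (hW : W.rank = nw) [Nonempty T.edgeSet]
    {s : ℕ} (hs : ∀ e, s ≤ edgeSecrecy W e) :
    ∃ (S : OmniscienceScheme (treeSource T len W)) (K : KeyScheme (treeSource T len W)),
      (∀ n, K.disc n = S.disc n ∧ IsLinearNonInteractive (S.disc n)) ∧
      S.leakageRate = (((((∑ e, len e : ℕ) : ℝ) - nw) * Real.logb 2 (Nat.card F) -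
        s * Real.logb 2 (Nat.card F) : ℝ) : EReal) ∧
      K.rate = ((s * Real.logb 2 (Nat.card F) : ℝ) : EReal) := by
  choose D E key E' hlin hE hkey hE' hcond hmut using exists_linearDiscussion W hT hW hs
  have hrate := tendsto_truncated_rate s (Fintype.card T.edgeSet)
  have hlogb : ∀ n, Real.logb 2 ((Nat.card F ^ (n * s - Fintype.card T.edgeSet) : ℕ) : ℝ) =
      (n * s - Fintype.card T.edgeSet : ℕ) * Real.logb 2 (Nat.card F) := by
    intro n
    rw [Nat.cast_pow, Real.logb_pow]
  refine ⟨⟨D, E, ?_⟩, ⟨D, _, E', key, hkey, ?_, ?_⟩, fun n => ⟨rfl, hlin n⟩, ?_, ?_⟩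
  · simp [hE]
  · simp [hE']
  · simp only [hcond, hlogb, sub_self, tendsto_const_nhds]
  · refine ((continuous_coe_real_ereal.tendsto _).comp (Tendsto.congr' ?_
      ((hrate.mul_const (Real.logb 2 (Nat.card F))).const_sub
        ((((∑ e, len e : ℕ) : ℝ) - nw) * Real.logb 2 (Nat.card F))))).limsup_eq
    filter_upwards [eventually_gt_atTop 0] with n hn
    have hn' : (0 : ℝ) < n := by exact_mod_cast hn
    rw [hmut]
    field_simp
  · refine ((continuous_coe_real_ereal.tendsto _).comp (Tendsto.congr ?_
      (hrate.mul_const (Real.logb 2 (Nat.card F))))).liminf_eq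
    intro n
    rw [hlogb]
    ring

end Rates

end TreePIN

end

open TreePIN
theorem theorem1 {V : Type} [Fintype V] [Nontrivial V] (T : SimpleGraph V) [Fintype T.edgeSet]
    (hT : T.IsTree) {F : Type} [Field F] [Finite F] (len : T.edgeSet → ℕ) {nw : ℕ}
    (W : Matrix (Σ e : T.edgeSet, Fin (len e)) (Fin nw) F) (hW : W.rank = nw)
    {γ : T.edgeSet → Type} [∀ e, Finite (γ e)] (G : ∀ e, (treeSource T len W).Base → γ e)
    (hG : ∀ e, IsMaximalCommonFunction (treeSource T len W).baseLaw
      (edgeVector T len W e) (treeSource T len W).wt (G e)) :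
    wiretapKeyCapacity (treeSource T len W) =
        ⨅ e : T.edgeSet,
          ((condEntropy (treeSource T len W).baseLaw (edgeVector T len W e) (G e) : ℝ) : EReal) ∧
      minLeakageRate (treeSource T len W) =
        (((((∑ e, len e : ℕ) : ℝ) - (nw : ℝ)) * Real.logb 2 (Nat.card F) : ℝ) : EReal) -
          wiretapKeyCapacity (treeSource T len W) ∧
      ∃ (S : OmniscienceScheme (treeSource T len W)) (K : KeyScheme (treeSource T len W)),
        (∀ n, K.disc n = S.disc n ∧ IsLinearNonInteractive (S.disc n)) ∧
          S.leakageRate = minLeakageRate (treeSource T len W) ∧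
          K.rate = wiretapKeyCapacity (treeSource T len W) := by
  have : Nonempty T.edgeSet := by
    obtain ⟨a⟩ := hT.connected.nonempty
    obtain ⟨b, hab⟩ := hT.connected.preconnected.exists_adj_of_nontrivial a
    exact ⟨⟨s(a, b), hab⟩⟩
  obtain ⟨e₀, he₀⟩ := Finite.exists_min (edgeSecrecy W)
  obtain ⟨S, K, hlin, hS, hK⟩ := exists_schemes W hT.connected hW he₀
  have hlog : 0 ≤ Real.logb 2 (Nat.card F) :=
    Real.logb_nonneg (by norm_num) (by exact_mod_cast Nat.card_pos)
  have hmin : ⨅ e : T.edgeSet,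
      ((condEntropy (treeSource T len W).baseLaw (edgeVector T len W e) (G e) : ℝ) : EReal) =
      ((edgeSecrecy W e₀ * Real.logb 2 (Nat.card F) : ℝ) : EReal) := by
    simp only [fun e => condEntropy_edgeVector W (hG e)]
    refine le_antisymm (iInf_le _ e₀) (le_iInf fun e => EReal.coe_le_coe_iff.2 ?_)
    exact mul_le_mul_of_nonneg_right (by exact_mod_cast he₀ e) hlog
  have hcap : wiretapKeyCapacity (treeSource T len W) =
      ((edgeSecrecy W e₀ * Real.logb 2 (Nat.card F) : ℝ) : EReal) :=
    le_antisymm (iSup_le fun S => S.rate_le W hT e₀) (hK ▸ le_iSup KeyScheme.rate K)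
  have hleak : minLeakageRate (treeSource T len W) =
      (((((∑ e, len e : ℕ) : ℝ) - nw) * Real.logb 2 (Nat.card F) -
        edgeSecrecy W e₀ * Real.logb 2 (Nat.card F) : ℝ) : EReal) :=
    le_antisymm (hS ▸ iInf_le OmniscienceScheme.leakageRate S)
      (le_iInf fun S => le_leakageRate W hT hW S e₀)
  refine ⟨hcap.trans hmin.symm, ?_, S, K, hlin, hS.trans hleak.symm, hK.trans hcap.symm⟩
  rw [hleak, hcap, EReal.coe_sub]
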